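/- Let $1/2<H\le 1$, $\sigma>0$, $p\ge 2$, and let $\lambda_1,\dots,\lambda_p>0$ be pairwise distinct. Let $\{B_H(t)\}_{t\in\mathbb{R}}$ be a fractional Brownian motion with Hurst parameter $H$, that is, an almost surely continuous centered Gaussian process with $\mathbb{E}(B_H(t)B_H(s))=\frac12\left(|t|^{2H}+|s|^{2H}-|t-s|^{2H}\right)$. For $\lambda>0$ and a path $y$ let $T_\lambda(y)(t)=\int_{-\infty}^t e^{-\lambda(t-s)}\,dy(s)$ (an improper Riemann–Stieltjes integral). Write $\{X_t\}_{t\in\mathbb{R}}\sim\mathrm{FOU}(\lambda_1,\dots,\lambda_p,\sigma,H)$ if $X_t=\left(T_{\lambda_1}\circ\cdots\circ T_{\lambda_p}\right)(\sigma B_H)(t)$ almost surely for every $t$, and similarly $\mathrm{FOU}(\lambda,\sigma,H)$ if $X_t=T_\lambda(\sigma B_H)(t)$. For $x\ge 0$ put $$f_H(x)=e^{-x}\left(\Gamma(2H)-\int_0^x e^{s}s^{2H-1}\,ds\right)+e^{x}\left(\Gamma(2H)-\int_0^x e^{-s}s^{2H-1}\,ds\right).$$ If $\{X_t\}\sim\mathrm{FOU}(\lambda_1,\dots,\lambda_p,\sigma,H)$,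 then for every $t\in\mathbb{R}$ the variable $X_0X_t$ is integrable and $$\mathbb{E}(X_0X_t)=\frac{\sigma^2H}{2}\sum_{i=1}^p\frac{\lambda_i^{2p-2H-2}}{\prod_{j\ne i}(\lambda_i^2-\lambda_j^2)}\,f_H(\lambda_i|t|).$$ Consequently the autocovariance of $X$ is a linear combination of those of the $\mathrm{FOU}(\lambda_i,\sigma,H)$ processes: for any processes $Y^{(i)}\sim\mathrm{FOU}(\lambda_i,\sigma,H)$, $i=1,\dots,p$ (possibly on different probability spaces), each $Y^{(i)}_0Y^{(i)}_t$ is integrable and $$\mathbb{E}(X_0X_t)=\sum_{i=1}^p\frac{\lambda_i^{2p-2}}{\prod_{j\ne i}(\lambda_i^2-\lambda_j^2)}\,\mathbb{E}\left(Y^{(i)}_0Y^{(i)}_t\right).$$ -/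

import Mathlib

open MeasureTheory ProbabilityTheory Filter Topology

/-- A fractional Brownian motion indexed by the real line, with Hurst parameter `H ∈ (0, 1]`. -/
structure IsFractionalBrownianMotion {Ω : Type*} [MeasurableSpace Ω]
    (H : ℝ) (B : ℝ → Ω → ℝ) (P : Measure Ω) : Prop where
  hurst_mem : H ∈ Set.Ioc (0 : ℝ) 1
  gaussian : IsGaussianProcess B P
  centered : ∀ t, ∫ ω, B t ω ∂P = 0
  covariance : ∀ t s, ∫ ω, B t ω * B s ω ∂P =
    (1 / 2) * (|t| ^ (2 * H) + |s| ^ (2 * H) - |t - s| ^ (2 * H))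
  continuous : ∀ᵐ ω ∂P, Continuous fun t => B t ω

/-- `I` is the Riemann-Stieltjes integral of `f` with respect to `y` over `[a, b]` (`a ≤ b`):
the limit of the sums `∑ f (ξ i) (y (x (i+1)) - y (x i))` over tagged partitions
`a = x 0 ≤ ξ 0 ≤ x 1 ≤ ξ 1 ≤ ⋯ ≤ x n = b` as the mesh tends to `0`. -/
def HasRSIntegral (f y : ℝ → ℝ) (a b I : ℝ) : Prop :=
  ∀ ε > 0, ∃ δ > 0, ∀ (n : ℕ) (x ξ : ℕ → ℝ), x 0 = a → x n = b →
    (∀ i < n, x i ≤ ξ i ∧ ξ i ≤ x (i + 1) ∧ x (i + 1) - x i < δ) →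
    |∑ i ∈ Finset.range n, f (ξ i) * (y (x (i + 1)) - y (x i)) - I| < ε

/-- `I` is the improper Riemann-Stieltjes integral of `f` with respect to `y` over `(-∞, t]`:
all the integrals over `[a, t]` exist, and they converge to `I` as `a → -∞`. -/
def HasImproperRSIntegral (f y : ℝ → ℝ) (t I : ℝ) : Prop :=
  ∃ F : ℝ → ℝ, (∀ a ≤ t, HasRSIntegral f y a t (F a)) ∧ Tendsto F atBot (𝓝 I)

open Classical in
/-- The Ornstein-Uhlenbeck operator `T_lam (y) (t) = ∫_{-∞}^t exp (-lam (t - s)) dy(s)`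
(with value `0` where the integral does not exist). -/
noncomputable def ouOperator (lam : ℝ) (y : ℝ → ℝ) (t : ℝ) : ℝ :=
  if h : ∃ I, HasImproperRSIntegral (fun s => Real.exp (-lam * (t - s))) y t I
  then h.choose else 0

/-- The composition `T_{lam 0} ∘ T_{lam 1} ∘ ⋯ ∘ T_{lam (p - 1)}`, applied to the path `y`. -/
noncomputable def ouComposition {p : ℕ} (lam : Fin p → ℝ) (y : ℝ → ℝ) : ℝ → ℝ :=
  (List.ofFn lam).foldr ouOperator y

/-- `X` is a version of the process `T_{lam 0} ∘ ⋯ ∘ T_{lam (p - 1)} (σ B)`, where `B` is a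
fractional Brownian motion with Hurst parameter `H`, and `σ` and the pairwise distinct `lam i`
are positive. -/
structure IsFOU {Ω : Type*} [MeasurableSpace Ω] {p : ℕ}
    (lam : Fin p → ℝ) (σ H : ℝ) (X : ℝ → Ω → ℝ) (P : Measure Ω) : Prop where
  lam_pos : ∀ i, 0 < lam i
  lam_injective : Function.Injective lam
  sigma_pos : 0 < σ
  exists_fbm : ∃ B : ℝ → Ω → ℝ, IsFractionalBrownianMotion H B P ∧
    ∀ t, X t =ᵐ[P] fun ω => ouComposition lam (fun s => σ * B s ω) t

/-- The first summand of `f_H`, used for `x ≥ 0`. -/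
noncomputable def fH1 (H x : ℝ) : ℝ :=
  Real.exp (-x) * (Real.Gamma (2 * H) - ∫ s in (0 : ℝ)..x, Real.exp s * s ^ (2 * H - 1))

/-- The second summand of `f_H`, used for `x ≥ 0`. -/
noncomputable def fH2 (H x : ℝ) : ℝ :=
  Real.exp x * (Real.Gamma (2 * H) - ∫ s in (0 : ℝ)..x, Real.exp (-s) * s ^ (2 * H - 1))

/-- The function `f_H`, used for `x ≥ 0`. -/
noncomputable def fH (H x : ℝ) : ℝ := fH1 H x + fH2 H x

/-! ### Riemann-Stieltjes integrals by parts -/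

/-! Almost every path of `B` is continuous and grows slower than any exponential, so integration by
parts gives, path by path, `T_a y = y - a * expConv a y`. The resolvent identity for `expConv` then
yields `T_a ∘ T_b = (a T_a - b T_b) / (a - b)`. By induction a composition with `p + 1` distinct
parameters is `∑ K_i T_{lam i}`, where `K_i = lam i ^ p / ∏_{j ≠ i} (lam i - lam j)`
(`ExpGrowth.ouComposition_eq`).

The covariance of `X` is thus a double sum of covariances of `T_a B (0)` and `T_b B (t)`. Since `T_a
B` is an exponential average of increments of `B`, Fubini and a two-sided resolvent identity give
`(a α_a + b β_b) / (2 (a + b))`, with `α_a` and `β_b` built from `φ(s) = |s| ^ (2 H)`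
(`integral_ou_mul_ou`). This kernel separates the indices, and partial fractions at `-lam i`
collapse the double sum to weights `lam i ^ (2 p) / ∏_{j ≠ i} (lam i ^ 2 - lam j ^ 2)` on `α_i +
β_i`. Finally `α_a + β_a = 2 H a ^ (-2 H) f_H(a |t|)`, because both sides are built from solutions
of the same linear ODEs with the same initial values. -/

theorem HasRSIntegral.unique {f y : ℝ → ℝ} {a b I J : ℝ} (hab : a ≤ b)
    (hI : HasRSIntegral f y a b I) (hJ : HasRSIntegral f y a b J) : I = J := by
  by_contra hne
  have hpos : 0 < |I - J| / 2 := half_pos (abs_pos.mpr (sub_ne_zero.mpr hne))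
  obtain ⟨δ, hδ, h1⟩ := hI _ hpos
  obtain ⟨δ', hδ', h2⟩ := hJ _ hpos
  obtain ⟨n, hn⟩ := exists_nat_gt ((b - a) / min δ δ')
  have hm : 0 < min δ δ' := lt_min hδ hδ'
  have hn0 : (0 : ℝ) < n := lt_of_le_of_lt (div_nonneg (sub_nonneg.mpr hab) hm.le) hn
  have hstep : (b - a) / n < min δ δ' := by
    rw [div_lt_iff₀ hm] at hn
    rw [div_lt_iff₀ hn0]; linarith
  have hstep0 : 0 ≤ (b - a) / n := div_nonneg (sub_nonneg.mpr hab) hn0.le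
  set x : ℕ → ℝ := fun i => a + i * ((b - a) / n) with hx
  have hx0 : x 0 = a := by simp [hx]
  have hxn : x n = b := by simp only [hx]; field_simp; ring
  have hxd : ∀ i, x (i + 1) - x i = (b - a) / n := fun i => by simp only [hx]; push_cast; ring
  have e1 := h1 n x x hx0 hxn fun i _ =>
    ⟨le_rfl, by linarith [hxd i], by rw [hxd]; exact hstep.trans_le (min_le_left _ _)⟩
  have e2 := h2 n x x hx0 hxn fun i _ =>
    ⟨le_rfl, by linarith [hxd i], by rw [hxd]; exact hstep.trans_le (min_le_right _ _)⟩
  rw [abs_sub_comm] at e1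
  have := abs_sub_le I (∑ i ∈ Finset.range n, f (x i) * (y (x (i + 1)) - y (x i))) J
  linarith

theorem HasImproperRSIntegral.unique {f y : ℝ → ℝ} {t I J : ℝ}
    (hI : HasImproperRSIntegral f y t I) (hJ : HasImproperRSIntegral f y t J) : I = J := by
  obtain ⟨F, hF, hF'⟩ := hI
  obtain ⟨G, hG, hG'⟩ := hJ
  refine tendsto_nhds_unique (hF'.congr' ?_) hG'
  filter_upwards [eventually_le_atBot t] with a ha
  exact (hF a ha).unique ha (hG a ha)

theorem abs_integral_deriv_mul_sub_le {f f' y : ℝ → ℝ} (hf : ∀ s, HasDerivAt f (f' s) s)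
    (hf'c : Continuous f') (hf' : ∀ s, 0 ≤ f' s) {u v c η : ℝ} (huv : u ≤ v)
    (h : ∀ s ∈ Set.Icc u v, |y s - c| ≤ η) :
    |∫ s in u..v, f' s * (y s - c)| ≤ η * (f v - f u) := by
  have h1 : ∫ s in u..v, η * f' s = η * (f v - f u) := by
    rw [intervalIntegral.integral_const_mul,
      intervalIntegral.integral_eq_sub_of_hasDerivAt (fun s _ => hf s) (hf'c.intervalIntegrable _ _)]
  rw [← h1, ← Real.norm_eq_abs]
  refine intervalIntegral.norm_integral_le_of_norm_le huv (Eventually.of_forall fun s hs => ?_)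
    ((continuous_const.mul hf'c).intervalIntegrable _ _)
  rw [Real.norm_eq_abs, abs_mul, abs_of_nonneg (hf' s), mul_comm]
  exact mul_le_mul_of_nonneg_right (h s ⟨hs.1.le, hs.2⟩) (hf' s)

/-- Integration by parts: the Riemann-Stieltjes integral of an increasing `C¹` function with respect
to a continuous path. -/
theorem hasRSIntegral_of_hasDerivAt {f f' y : ℝ → ℝ} (hf : ∀ s, HasDerivAt f (f' s) s)
    (hf'c : Continuous f') (hf' : ∀ s, 0 ≤ f' s) (hy : Continuous y) {a b : ℝ} (hab : a ≤ b) :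
    HasRSIntegral f y a b (f b * y b - f a * y a - ∫ s in a..b, f' s * y s) := by
  intro ε hε
  have hmono : Monotone f := monotone_of_hasDerivAt_nonneg hf hf'
  have hfab : 0 ≤ f b - f a := sub_nonneg.mpr (hmono hab)
  -- The cell errors will sum to at most `η * (f b - f a)`; the `+ 1` keeps the denominator positive
  -- and the final inequality strict.
  set η := ε / (f b - f a + 1) with hη
  have hη0 : 0 < η := by positivity
  obtain ⟨δ, hδ, hunif⟩ := Metric.uniformContinuousOn_iff.mp
    (isCompact_Icc.uniformContinuousOn_of_continuous (hy.continuousOn (s := Set.Icc a b))) η hη0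
  refine ⟨δ, hδ, fun n x ξ hx0 hxn hx => ?_⟩
  have hii : ∀ u v : ℝ, IntervalIntegrable (fun s => f' s * y s) volume u v :=
    fun u v => (hf'c.mul hy).intervalIntegrable u v
  have hsplit : ∀ c u v : ℝ, ∫ s in u..v, f' s * (y s - c) =
      (∫ s in u..v, f' s * y s) - c * (f v - f u) := by
    intro c u v
    have : ∫ s in u..v, f' s * c = c * (f v - f u) := by
      rw [intervalIntegral.integral_mul_const,
        intervalIntegral.integral_eq_sub_of_hasDerivAt (fun s _ => hf s)
          (hf'c.intervalIntegrable _ _), mul_comm]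
    rw [← this, ← intervalIntegral.integral_sub (hii u v)
      ((by fun_prop : Continuous fun s => f' s * c).intervalIntegrable _ _)]
    simp only [mul_sub]
  have hle : ∀ i < n, x i ≤ x (i + 1) := fun i hi => (hx i hi).1.trans (hx i hi).2.1
  have hge : ∀ i ≤ n, a ≤ x i := by
    intro i
    induction i with
    | zero => intro _; exact hx0.ge
    | succ i ih => intro hi; exact (ih (by omega)).trans (hle i (by omega))
  have hlb : ∀ k i, i + k = n → x i ≤ b := by
    intro k
    induction k with
    | zero => intro i hi; rw [← hxn, ← hi]; rfl
    | succ k ih => intro i hi; exact (hle i (by omega)).trans (ih (i + 1) (by omega))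
  set G : ℝ → ℝ := fun u => f u * y u - ∫ s in a..u, f' s * y s with hG
  have hI : f b * y b - f a * y a - ∫ s in a..b, f' s * y s =
      ∑ i ∈ Finset.range n, (G (x (i + 1)) - G (x i)) := by
    rw [Finset.sum_range_sub (fun i => G (x i)), hx0, hxn]
    simp only [hG, intervalIntegral.integral_same]; ring
  rw [hI, ← Finset.sum_sub_distrib]
  have hcell : ∀ i ∈ Finset.range n,
      |f (ξ i) * (y (x (i + 1)) - y (x i)) - (G (x (i + 1)) - G (x i))| ≤
        η * f (x (i + 1)) - η * f (x i) := by
    intro i hi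
    have hin := Finset.mem_range.mp hi
    obtain ⟨h1, h2, h3⟩ := hx i hin
    have ha := hge i hin.le
    have hb := hlb (n - (i + 1)) (i + 1) (by omega)
    -- Cutting the cell at its tag leaves only oscillations of `y` about the nearer end value,
    -- weighted by `f'`; the resulting bounds telescope in `f`.
    have key : f (ξ i) * (y (x (i + 1)) - y (x i)) - (G (x (i + 1)) - G (x i)) =
        (∫ s in (x i)..(ξ i), f' s * (y s - y (x i))) +
          ∫ s in (ξ i)..(x (i + 1)), f' s * (y s - y (x (i + 1))) := by
      rw [hsplit, hsplit]
      have e1 := intervalIntegral.integral_add_adjacent_intervals (hii a (x i)) (hii (x i) (ξ i))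
      have e2 := intervalIntegral.integral_add_adjacent_intervals (hii a (ξ i))
        (hii (ξ i) (x (i + 1)))
      simp only [hG]
      linear_combination -e1 - e2
    have b1 := abs_integral_deriv_mul_sub_le hf hf'c hf' (c := y (x i)) (η := η) h1 fun s hs =>
      (hunif s ⟨ha.trans hs.1, hs.2.trans (h2.trans hb)⟩ (x i)
        ⟨ha, (h1.trans h2).trans hb⟩ (by
          rw [Real.dist_eq, abs_of_nonneg (by linarith [hs.1])]; linarith [hs.2])).le
    have b2 := abs_integral_deriv_mul_sub_le hf hf'c hf' (c := y (x (i + 1))) (η := η) h2 fun s hs =>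
      (hunif s ⟨(ha.trans h1).trans hs.1, hs.2.trans hb⟩ (x (i + 1))
        ⟨ha.trans (h1.trans h2), hb⟩ (by
          rw [Real.dist_eq, abs_of_nonpos (by linarith [hs.2])]; linarith [hs.1])).le
    rw [key]
    refine (abs_add_le _ _).trans ?_
    linarith
  refine (Finset.abs_sum_le_sum_abs _ _).trans_lt ((Finset.sum_le_sum hcell).trans_lt ?_)
  rw [Finset.sum_range_sub (fun i => η * f (x i)), hx0, hxn, ← mul_sub, hη, div_mul_eq_mul_div,
    div_lt_iff₀ (by linarith)]
  nlinarith

/-! ### Exponential convolution on paths of exponential growth -/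

/-- Continuous functions on the line bounded by a multiple of `exp (μ |s|)`. -/
structure ExpGrowth (μ : ℝ) (y : ℝ → ℝ) : Prop where
  continuous : Continuous y
  bound : ∃ C, ∀ s, |y s| ≤ C * Real.exp (μ * |s|)

/-- The convolution `∫_{-∞}^t exp (-a (t - s)) y(s) ds`. -/
noncomputable def expConv (a : ℝ) (y : ℝ → ℝ) (t : ℝ) : ℝ :=
  Real.exp (-(a * t)) * ∫ s in Set.Iic t, Real.exp (a * s) * y s

namespace ExpGrowth

variable {μ a b : ℝ} {y z : ℝ → ℝ}

/-- On `s ≤ t` one has `|s| ≤ |t| + t - s`, which trades the two-sided bound for a pure exponential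
in `s`, integrable at `-∞` once `μ < a`. -/
theorem exists_bound_Iic (hy : ExpGrowth μ y) (hμ : 0 ≤ μ) : ∃ C, 0 ≤ C ∧ ∀ t s, s ≤ t →
    |Real.exp (a * s) * y s| ≤ C * Real.exp (μ * |t| + μ * t) * Real.exp ((a - μ) * s) := by
  obtain ⟨C, hC⟩ := hy.bound
  have hC0 : 0 ≤ C := by
    have := (abs_nonneg _).trans (hC 0)
    simpa using this
  refine ⟨C, hC0, fun t s hs => ?_⟩
  rw [abs_mul, Real.abs_exp, mul_assoc, ← Real.exp_add]
  have h1 : |s| ≤ |t| + (t - s) := by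
    have := abs_sub_abs_le_abs_sub s t
    rw [abs_sub_comm, abs_of_nonneg (sub_nonneg.mpr hs)] at this
    linarith
  have h2 := mul_le_mul_of_nonneg_left h1 hμ
  calc Real.exp (a * s) * |y s| ≤ Real.exp (a * s) * (C * Real.exp (μ * |s|)) :=
        mul_le_mul_of_nonneg_left (hC s) (Real.exp_pos _).le
    _ = C * Real.exp (a * s + μ * |s|) := by rw [Real.exp_add]; ring
    _ ≤ C * Real.exp (μ * |t| + μ * t + (a - μ) * s) :=
        mul_le_mul_of_nonneg_left (Real.exp_le_exp.mpr (by linarith)) hC0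
    _ = _ := by rw [Real.exp_add (μ * |t| + μ * t)]

theorem integrableOn_Iic (hy : ExpGrowth μ y) (hμ : 0 ≤ μ) (ha : μ < a) (t : ℝ) :
    IntegrableOn (fun s => Real.exp (a * s) * y s) (Set.Iic t) := by
  obtain ⟨C, -, hC⟩ := hy.exists_bound_Iic (a := a) hμ
  refine Integrable.mono' ((integrableOn_exp_mul_Iic (sub_pos.mpr ha) t).const_mul
    (C * Real.exp (μ * |t| + μ * t))) ?_ ?_
  · have := hy.continuous
    exact Continuous.aestronglyMeasurable (by fun_prop)
  · exact (ae_restrict_mem measurableSet_Iic).mono fun s hs => hC t s hs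

theorem hasDerivAt_integral_Iic (hy : ExpGrowth μ y) (hμ : 0 ≤ μ) (ha : μ < a) (t : ℝ) :
    HasDerivAt (fun t => ∫ s in Set.Iic t, Real.exp (a * s) * y s) (Real.exp (a * t) * y t) t := by
  have hc : Continuous fun s => Real.exp (a * s) * y s := by
    have := hy.continuous
    fun_prop
  have h := (hc.integral_hasStrictDerivAt 0 t).hasDerivAt.add_const
    (∫ s in Set.Iic (0 : ℝ), Real.exp (a * s) * y s)
  refine h.congr_of_eventuallyEq (Eventually.of_forall fun u => ?_)
  have := intervalIntegral.integral_Iic_sub_Iic (hy.integrableOn_Iic hμ ha 0)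
    (hy.integrableOn_Iic hμ ha u)
  simp only [← this]; ring

theorem hasDerivAt_expConv (hy : ExpGrowth μ y) (hμ : 0 ≤ μ) (ha : μ < a) (t : ℝ) :
    HasDerivAt (expConv a y) (y t - a * expConv a y t) t := by
  have h1 : HasDerivAt (fun t => Real.exp (-(a * t))) (Real.exp (-(a * t)) * -(a * 1)) t :=
    (((hasDerivAt_id t).const_mul a).neg).exp
  refine (h1.mul (hy.hasDerivAt_integral_Iic hμ ha t)).congr_deriv ?_
  have : Real.exp (-(a * t)) * Real.exp (a * t) = 1 := by rw [← Real.exp_add]; simp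
  simp only [expConv]
  linear_combination y t * this

theorem expConv (hy : ExpGrowth μ y) (hμ : 0 ≤ μ) (ha : μ < a) : ExpGrowth μ (expConv a y) := by
  refine ⟨continuous_iff_continuousAt.mpr fun t => (hy.hasDerivAt_expConv hμ ha t).continuousAt, ?_⟩
  obtain ⟨C, -, hC⟩ := hy.exists_bound_Iic (a := a) hμ
  refine ⟨C / (a - μ), fun t => ?_⟩
  have h1 : |∫ s in Set.Iic t, Real.exp (a * s) * y s| ≤
      C * Real.exp (μ * |t| + μ * t) * (Real.exp ((a - μ) * t) / (a - μ)) := by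
    rw [← integral_exp_mul_Iic (sub_pos.mpr ha), ← integral_const_mul, ← Real.norm_eq_abs]
    exact norm_integral_le_of_norm_le ((integrableOn_exp_mul_Iic (sub_pos.mpr ha) t).const_mul _)
      ((ae_restrict_mem measurableSet_Iic).mono fun s hs => hC t s hs)
  rw [_root_.expConv, abs_mul, Real.abs_exp]
  refine (mul_le_mul_of_nonneg_left h1 (Real.exp_pos _).le).trans_eq ?_
  have : Real.exp (μ * |t|) =
      Real.exp (-(a * t)) * Real.exp (μ * |t| + μ * t) * Real.exp ((a - μ) * t) := by
    rw [← Real.exp_add, ← Real.exp_add]; congr 1; ring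
  rw [this]; ring

theorem tendsto_exp_mul_atBot (hz : ExpGrowth μ z) (hμ : 0 ≤ μ) (ha : μ < a) :
    Tendsto (fun s => Real.exp (a * s) * z s) atBot (𝓝 0) := by
  obtain ⟨C, -, hC⟩ := hz.exists_bound_Iic (a := a) hμ
  have h0 : Tendsto (fun s : ℝ => C * Real.exp (μ * |0| + μ * 0) * Real.exp ((a - μ) * s))
      atBot (𝓝 (C * Real.exp (μ * |0| + μ * 0) * 0)) :=
    (Real.tendsto_exp_atBot.comp
      (tendsto_id.const_mul_atBot (sub_pos.mpr ha))).const_mul _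
  rw [mul_zero (C * _)] at h0
  refine squeeze_zero_norm' ?_ h0
  filter_upwards [eventually_le_atBot 0] with s hs using hC 0 s hs

/-- `expConv a y` is the only solution of `z' = y - a z` of small exponential growth. -/
theorem eq_expConv (hy : ExpGrowth μ y) (hz : ExpGrowth μ z) (hμ : 0 ≤ μ) (ha : μ < a)
    (h : ∀ t, HasDerivAt z (y t - a * z t) t) : z = _root_.expConv a y := by
  ext t
  have hd : ∀ s, HasDerivAt (fun s => Real.exp (a * s) * z s) (Real.exp (a * s) * y s) s := by
    intro s
    have h1 : HasDerivAt (fun t => Real.exp (a * t)) (Real.exp (a * s) * (a * 1)) s :=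
      ((hasDerivAt_id s).const_mul a).exp
    refine (h1.mul (h s)).congr_deriv ?_
    ring
  have := integral_Iic_of_hasDerivAt_of_tendsto' (fun s (_ : s ∈ Set.Iic t) => hd s)
    (hy.integrableOn_Iic hμ ha t) (hz.tendsto_exp_mul_atBot hμ ha)
  rw [_root_.expConv, this, sub_zero, ← mul_assoc, ← Real.exp_add]
  simp

theorem add (hy : ExpGrowth μ y) (hz : ExpGrowth μ z) : ExpGrowth μ fun s => y s + z s := by
  obtain ⟨C, hC⟩ := hy.bound
  obtain ⟨D, hD⟩ := hz.bound
  exact ⟨hy.continuous.add hz.continuous, C + D, fun s =>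
    (abs_add_le _ _).trans (by rw [add_mul]; exact add_le_add (hC s) (hD s))⟩

theorem const_mul (hy : ExpGrowth μ y) (c : ℝ) : ExpGrowth μ fun s => c * y s := by
  obtain ⟨C, hC⟩ := hy.bound
  exact ⟨continuous_const.mul hy.continuous, |c| * C, fun s => by
    rw [abs_mul, mul_assoc]; exact mul_le_mul_of_nonneg_left (hC s) (abs_nonneg c)⟩

theorem comp_neg (hy : ExpGrowth μ y) : ExpGrowth μ fun s => y (-s) := by
  obtain ⟨C, hC⟩ := hy.bound
  exact ⟨hy.continuous.comp continuous_neg, C, fun s => by simpa using hC (-s)⟩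

/-- Resolvent identity. -/
theorem expConv_expConv (hy : ExpGrowth μ y) (hμ : 0 ≤ μ) (ha : μ < a) (hb : μ < b) (hab : a ≠ b)
    (t : ℝ) : _root_.expConv a (_root_.expConv b y) t =
      (_root_.expConv b y t - _root_.expConv a y t) / (a - b) := by
  have hab' : a - b ≠ 0 := sub_ne_zero.mpr hab
  -- The claimed value solves `z' = expConv b y - a z`, so the uniqueness in `eq_expConv` identifies
  -- it.
  have hz : ExpGrowth μ fun s =>
      (a - b)⁻¹ * _root_.expConv b y s + -(a - b)⁻¹ * _root_.expConv a y s :=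
    ((hy.expConv hμ hb).const_mul _).add ((hy.expConv hμ ha).const_mul _)
  rw [← (hy.expConv hμ hb).eq_expConv hz hμ ha]
  · field_simp; ring
  · intro s
    refine (((hy.hasDerivAt_expConv hμ hb s).const_mul _).add
      ((hy.hasDerivAt_expConv hμ ha s).const_mul _)).congr_deriv ?_
    field_simp; ring

/-- The two-sided version of the resolvent identity, for an even function. -/
theorem expConv_comp_neg_expConv (hy : ExpGrowth μ y) (heven : ∀ s, y (-s) = y s) (hμ : 0 ≤ μ)
    (ha : μ < a) (hb : μ < b) (t : ℝ) :
    _root_.expConv a (fun s => _root_.expConv b y (-s)) t =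
      (_root_.expConv a y t + _root_.expConv b y (-t)) / (a + b) := by
  have hab' : a + b ≠ 0 := by linarith
  have hz : ExpGrowth μ fun s =>
      (a + b)⁻¹ * _root_.expConv a y s + (a + b)⁻¹ * _root_.expConv b y (-s) :=
    ((hy.expConv hμ ha).const_mul _).add (((hy.expConv hμ hb).comp_neg).const_mul _)
  rw [← ((hy.expConv hμ hb).comp_neg).eq_expConv hz hμ ha]
  · field_simp
  · intro s
    have h2 : HasDerivAt (fun s => _root_.expConv b y (-s))
        (-(y (-s) - b * _root_.expConv b y (-s))) s := by
      exact ((hy.hasDerivAt_expConv hμ hb (-s)).comp s (hasDerivAt_neg s)).congr_deriv (by ring)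
    refine (((hy.hasDerivAt_expConv hμ ha s).const_mul _).add (h2.const_mul _)).congr_deriv ?_
    -- Evenness makes the reflected source term `y (-s)` cancel against `y s`.
    rw [heven]
    field_simp; ring

theorem expConv_eq_integral_Ioi (a : ℝ) (y : ℝ → ℝ) (t : ℝ) :
    _root_.expConv a y t = ∫ u in Set.Ioi 0, Real.exp (-(a * u)) * y (t - u) := by
  have h := integral_comp_neg_Iic (-0 : ℝ) fun u => Real.exp (-(a * u)) * y (t - u)
  simp only [neg_neg] at h
  rw [← h, neg_zero, _root_.expConv, ← integral_const_mul,
    ← (measurePreserving_add_right volume t).setIntegral_preimage_emb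
      (measurableEmbedding_addRight t) _ (Set.Iic t)]
  have : (fun x => x + t) ⁻¹' Set.Iic t = Set.Iic 0 := by ext; simp
  rw [this]
  refine integral_congr_ae (Eventually.of_forall fun x => ?_)
  simp only
  rw [← mul_assoc, ← Real.exp_add]
  congr 2 <;> ring

theorem integrableOn_Ioi (hy : ExpGrowth μ y) (hμ : 0 ≤ μ) (ha : μ < a) (t : ℝ) :
    IntegrableOn (fun u => Real.exp (-(a * u)) * y (t - u)) (Set.Ioi 0) := by
  obtain ⟨C, hC0, hC⟩ := hy.exists_bound_Iic (a := a) hμ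
  refine Integrable.mono' ((integrableOn_exp_mul_Ioi (a := -(a - μ)) (by linarith) 0).const_mul
    (Real.exp (-(a * t)) * (C * Real.exp (μ * |t| + μ * t)) * Real.exp ((a - μ) * t))) ?_ ?_
  · have := hy.continuous
    exact Continuous.aestronglyMeasurable (by fun_prop)
  · refine (ae_restrict_mem measurableSet_Ioi).mono fun u hu => ?_
    have h := hC t (t - u) (by linarith [Set.mem_Ioi.mp hu])
    have e1 : Real.exp (-(a * u)) = Real.exp (-(a * t)) * Real.exp (a * (t - u)) := by
      rw [← Real.exp_add]; congr 1; ring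
    have e2 : Real.exp ((a - μ) * (t - u)) = Real.exp ((a - μ) * t) * Real.exp (-(a - μ) * u) := by
      rw [← Real.exp_add]; congr 1; ring
    rw [e2] at h
    rw [e1, mul_assoc, norm_mul, Real.norm_eq_abs, Real.abs_exp, Real.norm_eq_abs]
    refine (mul_le_mul_of_nonneg_left h (Real.exp_pos _).le).trans_eq ?_
    ring

end ExpGrowth

/-! ### The Ornstein-Uhlenbeck operator and its compositions -/

theorem ouOperator_eq_of_hasImproperRSIntegral {a t I : ℝ} {y : ℝ → ℝ}
    (h : HasImproperRSIntegral (fun s => Real.exp (-a * (t - s))) y t I) :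
    ouOperator a y t = I := by
  have hex : ∃ I, HasImproperRSIntegral (fun s => Real.exp (-a * (t - s))) y t I := ⟨I, h⟩
  rw [ouOperator, dif_pos hex]
  exact hex.choose_spec.unique h

/-- Integration by parts on `[u, t]`, then `u → -∞`: the boundary term at `u` vanishes because `μ <
a`. -/
theorem ExpGrowth.ouOperator_eq {μ a : ℝ} {y : ℝ → ℝ} (hy : ExpGrowth μ y) (hμ : 0 ≤ μ)
    (ha : μ < a) (t : ℝ) : ouOperator a y t = y t - a * _root_.expConv a y t := by
  have ha0 : 0 < a := hμ.trans_lt ha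
  refine ouOperator_eq_of_hasImproperRSIntegral
    ⟨fun u => Real.exp (-a * (t - t)) * y t - Real.exp (-a * (t - u)) * y u -
      ∫ s in u..t, a * Real.exp (-a * (t - s)) * y s, fun u hu => ?_, ?_⟩
  · refine hasRSIntegral_of_hasDerivAt (f' := fun s => a * Real.exp (-a * (t - s))) (fun s => ?_)
      (by fun_prop) (fun s => by positivity) hy.continuous hu
    refine (((hasDerivAt_id s).const_sub t).const_mul (-a)).exp.congr_deriv ?_
    simp only [id]; ring
  · have h1 := (hy.tendsto_exp_mul_atBot hμ ha).const_mul (Real.exp (-(a * t)))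
    have h2 := (intervalIntegral_tendsto_integral_Iic t (hy.integrableOn_Iic hμ ha t)
      tendsto_id).const_mul (a * Real.exp (-(a * t)))
    refine (((tendsto_const_nhds (x := y t)).sub h1).sub h2).congr' ?_ |>.trans_eq ?_
    · refine Eventually.of_forall fun u => ?_
      have e : ∀ s, Real.exp (-a * (t - s)) = Real.exp (-(a * t)) * Real.exp (a * s) := by
        intro s; rw [← Real.exp_add]; congr 1; ring
      simp only [e, id]
      rw [← intervalIntegral.integral_const_mul]
      have : Real.exp (-(a * t)) * Real.exp (a * t) = 1 := by rw [← Real.exp_add]; simp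
      rw [this]
      simp only [mul_assoc, one_mul]
    · simp only [_root_.expConv, mul_zero, sub_zero, mul_assoc]

theorem expConv_sum {ι : Type*} (s : Finset ι) (a : ℝ) (c : ι → ℝ) (f : ι → ℝ → ℝ) (t : ℝ)
    (hf : ∀ i ∈ s, IntegrableOn (fun u => Real.exp (a * u) * f i u) (Set.Iic t)) :
    expConv a (fun u => ∑ i ∈ s, c i * f i u) t = ∑ i ∈ s, c i * expConv a (f i) t := by
  have : ∀ u, Real.exp (a * u) * ∑ i ∈ s, c i * f i u =
      ∑ i ∈ s, c i * (Real.exp (a * u) * f i u) := fun u => by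
    rw [Finset.mul_sum]; exact Finset.sum_congr rfl fun i _ => by ring
  simp only [expConv, this]
  rw [integral_finsetSum _ fun i hi => (hf i hi).const_mul _, Finset.mul_sum]
  refine Finset.sum_congr rfl fun i _ => ?_
  rw [integral_const_mul]; ring

theorem expConv_sub_const_mul (a c : ℝ) (f g : ℝ → ℝ) (t : ℝ)
    (hf : IntegrableOn (fun u => Real.exp (a * u) * f u) (Set.Iic t))
    (hg : IntegrableOn (fun u => Real.exp (a * u) * g u) (Set.Iic t)) :
    expConv a (fun u => f u - c * g u) t = expConv a f t - c * expConv a g t := by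
  have : ∀ u, Real.exp (a * u) * (f u - c * g u) =
      Real.exp (a * u) * f u - c * (Real.exp (a * u) * g u) := fun u => by ring
  simp only [expConv, this]
  rw [integral_sub hf (hg.const_mul _), integral_const_mul]; ring

theorem ExpGrowth.sub_const_mul {μ : ℝ} {y z : ℝ → ℝ} (hy : ExpGrowth μ y) (hz : ExpGrowth μ z)
    (c : ℝ) : ExpGrowth μ fun s => y s - c * z s := by
  simpa [sub_eq_add_neg] using hy.add (hz.const_mul (-c))

theorem ExpGrowth.sum {ι : Type*} {μ : ℝ} (s : Finset ι) (c : ι → ℝ) {f : ι → ℝ → ℝ}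
    (hf : ∀ i ∈ s, ExpGrowth μ (f i)) : ExpGrowth μ fun u => ∑ i ∈ s, c i * f i u := by
  classical
  induction s using Finset.induction_on with
  | empty => exact ⟨by simpa using continuous_const, 0, by simp⟩
  | insert i s hi ih =>
    simp only [Finset.sum_insert hi]
    exact ((hf i (by simp)).const_mul _).add (ih fun j hj => hf j (by simp [hj]))

/-- The composition of two Ornstein-Uhlenbeck operators. -/
theorem ExpGrowth.sub_expConv_sub_expConv {μ a b : ℝ} {y : ℝ → ℝ} (hy : ExpGrowth μ y)
    (hμ : 0 ≤ μ) (ha : μ < a) (hb : μ < b) (hab : a ≠ b) (t : ℝ) :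
    (y t - b * _root_.expConv b y t) -
      a * _root_.expConv a (fun s => y s - b * _root_.expConv b y s) t =
    (a * (y t - a * _root_.expConv a y t) - b * (y t - b * _root_.expConv b y t)) / (a - b) := by
  rw [expConv_sub_const_mul _ _ _ _ _ (hy.integrableOn_Iic hμ ha t)
    ((hy.expConv hμ hb).integrableOn_Iic hμ ha t), hy.expConv_expConv hμ ha hb hab]
  have : a - b ≠ 0 := sub_ne_zero.mpr hab
  field_simp; ring

/-! ### Partial fractions -/

/-- The polynomial `X ^ p` has degree below the number of nodes, so it equals its Lagrange
interpolant; dividing the barycentric form by the nodal polynomial gives the identity. -/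
theorem sum_nodalWeight_mul_inv_sub_mul_pow {p : ℕ} {v : Fin (p + 1) → ℝ}
    (hv : Function.Injective v) {x : ℝ} (hx : ∀ i, x ≠ v i) :
    ∑ i, v i ^ p * Lagrange.nodalWeight Finset.univ v i * (x - v i)⁻¹ =
      x ^ p * ∏ i, (x - v i)⁻¹ := by
  have h := Lagrange.eval_interpolate_not_at_node (s := Finset.univ) (v := v)
    (fun i => (Polynomial.X ^ p : Polynomial ℝ).eval (v i)) (x := x) fun i _ => hx i
  rw [← Lagrange.eq_interpolate hv.injOn (by simp; norm_cast; omega),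
    Lagrange.eval_nodal] at h
  have hne : ∏ i, (x - v i) ≠ 0 := Finset.prod_ne_zero_iff.mpr fun i _ => sub_ne_zero.mpr (hx i)
  simp only [Polynomial.eval_pow, Polynomial.eval_X] at h
  rw [Finset.prod_inv_distrib, h, mul_comm, ← mul_assoc, inv_mul_cancel₀ hne, one_mul]
  exact Finset.sum_congr rfl fun i _ => by ring

theorem nodalWeight_univ_eq_prod_ite {p : ℕ} (v : Fin p → ℝ) (i : Fin p) :
    Lagrange.nodalWeight Finset.univ v i = ∏ j, if j ≠ i then (v i - v j)⁻¹ else 1 := by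
  rw [Lagrange.nodalWeight, ← Finset.filter_ne', Finset.prod_filter]

theorem nodalWeight_univ_zero {p : ℕ} (v : Fin (p + 1) → ℝ) :
    Lagrange.nodalWeight Finset.univ v 0 = ∏ j : Fin p, (v 0 - v j.succ)⁻¹ := by
  simp [nodalWeight_univ_eq_prod_ite, Fin.prod_univ_succ]

theorem nodalWeight_univ_succ {p : ℕ} (v : Fin (p + 1) → ℝ) (i : Fin p) :
    Lagrange.nodalWeight Finset.univ v i.succ = (v i.succ - v 0)⁻¹ *
      Lagrange.nodalWeight Finset.univ (fun j => v j.succ) i := by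
  simp [nodalWeight_univ_eq_prod_ite, Fin.prod_univ_succ, (Fin.succ_ne_zero i).symm]

/-- Partial fractions evaluated at `x = -v i`. The factor `1 / 2` comes from the diagonal term `v i
+ v i`; the remaining factors `v i + v j` pair with the `v i - v j` of the nodal weight. -/
theorem sum_pow_mul_nodalWeight_div_add {p : ℕ} {v : Fin (p + 1) → ℝ}
    (hv : Function.Injective v) (hpos : ∀ i, 0 < v i) (i : Fin (p + 1)) :
    v i ^ p * Lagrange.nodalWeight Finset.univ v i * v i *
      ∑ j, v j ^ p * Lagrange.nodalWeight Finset.univ v j / (v i + v j) =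
    v i ^ (2 * p) / (∏ j ∈ Finset.univ.erase i, (v i ^ 2 - v j ^ 2)) / 2 := by
  have h := sum_nodalWeight_mul_inv_sub_mul_pow hv (x := -v i)
    fun j => by linarith [hpos i, hpos j]
  have e : ∀ j, (-v i - v j)⁻¹ = -1 * (v i + v j)⁻¹ := fun j => by
    rw [show -v i - v j = -(v i + v j) by ring, inv_neg]; ring
  simp only [e, Finset.prod_mul_distrib, Finset.prod_const, Finset.card_univ, Fintype.card_fin] at h
  have h' : ∑ j, v j ^ p * Lagrange.nodalWeight Finset.univ v j / (v i + v j) =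
      v i ^ p * ∏ j, (v i + v j)⁻¹ := by
    have h1 : (-1 : ℝ) ^ p * (-1) ^ p = 1 := by rw [← mul_pow]; simp
    have : (-v i) ^ p = (-1) ^ p * v i ^ p := by rw [← mul_pow]; simp
    have h2 : ∑ j, v j ^ p * Lagrange.nodalWeight Finset.univ v j * (-1 * (v i + v j)⁻¹) =
        - ∑ j, v j ^ p * Lagrange.nodalWeight Finset.univ v j / (v i + v j) := by
      rw [← Finset.sum_neg_distrib]
      exact Finset.sum_congr rfl fun j _ => by ring
    rw [h2, this, pow_succ] at h
    linear_combination -h + v i ^ p * (∏ j, (v i + v j)⁻¹) * h1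
  rw [h', ← Finset.mul_prod_erase Finset.univ _ (Finset.mem_univ i), Lagrange.nodalWeight]
  have e2 : ∀ j, v i ^ 2 - v j ^ 2 = (v i - v j) * (v i + v j) := fun j => by ring
  simp only [e2, Finset.prod_mul_distrib, Finset.prod_inv_distrib]
  have := (hpos i).ne'
  rw [div_div, div_eq_mul_inv _ (_ * _), mul_inv, mul_inv, two_mul p, pow_add]
  field_simp
  norm_num

/-! ### Compositions of Ornstein-Uhlenbeck operators as linear combinations -/

theorem ouComposition_succ {p : ℕ} (lam : Fin (p + 1) → ℝ) (y : ℝ → ℝ) :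
    ouComposition lam y = ouOperator (lam 0) (ouComposition (fun i => lam i.succ) y) := by
  simp [ouComposition, List.ofFn_succ]

/-- Applying the outermost operator to each summand splits it by the two-operator identity. The
contributions to `T_{lam 0}` add up to the required coefficient by partial fractions at `x = lam 0`.
-/
theorem ExpGrowth.ouComposition_eq {μ : ℝ} {y : ℝ → ℝ} (hy : ExpGrowth μ y) (hμ : 0 ≤ μ) {p : ℕ}
    (lam : Fin (p + 1) → ℝ) (hinj : Function.Injective lam) (hlam : ∀ i, μ < lam i) (t : ℝ) :
    ouComposition lam y t = ∑ i, lam i ^ p * Lagrange.nodalWeight Finset.univ lam i *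
      (y t - lam i * _root_.expConv (lam i) y t) := by
  induction p generalizing t with
  | zero =>
    rw [Fin.sum_univ_succ, nodalWeight_univ_zero]
    simp [ouComposition, hy.ouOperator_eq hμ (hlam 0)]
  | succ p ih =>
    have hinj' : Function.Injective fun i : Fin (p + 1) => lam i.succ :=
      hinj.comp (Fin.succ_injective _)
    have hO : ∀ i ∈ Finset.univ, ExpGrowth μ fun s =>
        y s - lam (Fin.succ i) * _root_.expConv (lam (Fin.succ i)) y s := fun i _ =>
      hy.sub_const_mul (hy.expConv hμ (hlam _)) _
    have hne : ∀ i : Fin (p + 1), lam 0 ≠ lam i.succ := fun i h =>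
      (Fin.succ_ne_zero i) (hinj h).symm
    conv_rhs => rw [Fin.sum_univ_succ]
    rw [ouComposition_succ, funext (ih _ hinj' fun i => hlam i.succ),
      (ExpGrowth.sum Finset.univ _ hO).ouOperator_eq hμ (hlam 0),
      expConv_sum _ _ _ _ _ fun i hi => (hO i hi).integrableOn_Iic hμ (hlam 0) t,
      Finset.mul_sum, ← Finset.sum_sub_distrib, nodalWeight_univ_zero, pow_succ',
      mul_assoc (lam 0), ← sum_nodalWeight_mul_inv_sub_mul_pow hinj' hne, Finset.mul_sum,
      Finset.sum_mul, ← Finset.sum_add_distrib]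
    refine Finset.sum_congr rfl fun i _ => ?_
    have key := hy.sub_expConv_sub_expConv hμ (hlam 0) (hlam i.succ) (hne i) t
    rw [nodalWeight_univ_succ]
    have h1 : lam 0 - lam i.succ ≠ 0 := sub_ne_zero.mpr (hne i)
    have h2 : (lam i.succ - lam 0)⁻¹ = -(lam 0 - lam i.succ)⁻¹ := by rw [← inv_neg]; congr 1; ring
    rw [h2]
    linear_combination (lam i.succ ^ p * Lagrange.nodalWeight Finset.univ (fun j => lam j.succ) i)
      * key

/-! ### Growth of continuous functions with controlled dyadic increments -/

/-- Chaining: an even point of level `k + 1` already lies in level `k`, an odd one is a single step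
from its left neighbour, at a cost of order `r ^ (k + 1)`. Walking along the integers at level `0`
sums linear weights, hence the square. -/
theorem abs_sub_le_of_dyadic {z : ℝ → ℝ} {r W : ℝ} (hr : 0 ≤ r) (hW : 0 ≤ W)
    (h : ∀ k j : ℕ, |z ((j + 1) / 2 ^ k) - z (j / 2 ^ k)| ≤ W * r ^ k * (1 + j / 2 ^ k))
    (k j : ℕ) :
    |z (j / 2 ^ k) - z 0| ≤ W * (1 + j / 2 ^ k) ^ 2 * ∑ i ∈ Finset.range (k + 1), r ^ i := by
  induction k generalizing j with
  | zero =>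
    induction j with
    | zero => simpa using hW
    | succ j ih =>
      have h1 := h 0 j
      simp only [pow_zero, div_one, mul_one, zero_add, Finset.range_one, Finset.sum_singleton]
        at h1 ih ⊢
      push_cast
      have h2 := abs_sub_le (z (j + 1)) (z j) (z 0)
      have h3 : (0 : ℝ) ≤ j := j.cast_nonneg
      nlinarith [mul_nonneg hW h3]
  | succ k ih =>
    obtain ⟨m, rfl | rfl⟩ := Nat.even_or_odd' j
    · have e : ((2 * m : ℕ) : ℝ) / 2 ^ (k + 1) = m / 2 ^ k := by
        push_cast; rw [pow_succ]; field_simp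
      rw [e]
      refine (ih m).trans (mul_le_mul_of_nonneg_left ?_ (by positivity))
      rw [Finset.sum_range_succ _ (k + 1)]
      exact le_add_of_nonneg_right (by positivity)
    · have e : (m : ℝ) / 2 ^ k = ((2 * m : ℕ) : ℝ) / 2 ^ (k + 1) := by
        push_cast; rw [pow_succ]; field_simp
      have h1 := h (k + 1) (2 * m)
      have h2 := ih m
      rw [e] at h2
      set u : ℝ := ((2 * m : ℕ) : ℝ) / 2 ^ (k + 1) with hu
      have hu0 : 0 ≤ u := by positivity
      have e' : (((2 * m : ℕ) : ℝ) + 1) / 2 ^ (k + 1) = ((2 * m + 1 : ℕ) : ℝ) / 2 ^ (k + 1) := by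
        push_cast; rfl
      rw [e'] at h1
      set v : ℝ := ((2 * m + 1 : ℕ) : ℝ) / 2 ^ (k + 1) with hv
      have huv : u ≤ v := by rw [hu, hv]; gcongr; omega
      have hS : 0 ≤ ∑ i ∈ Finset.range (k + 1), r ^ i := by positivity
      have hrk : 0 ≤ r ^ (k + 1) := by positivity
      rw [Finset.sum_range_succ _ (k + 1)]
      have h3 : W * (1 + u) ^ 2 * ∑ i ∈ Finset.range (k + 1), r ^ i ≤
          W * (1 + v) ^ 2 * ∑ i ∈ Finset.range (k + 1), r ^ i := by gcongr
      have h4 : W * r ^ (k + 1) * (1 + u) ≤ W * r ^ (k + 1) * (1 + v) ^ 2 := by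
        refine mul_le_mul_of_nonneg_left ?_ (by positivity)
        nlinarith
      have h5 := abs_sub_le (z v) (z u) (z 0)
      linarith

theorem abs_sub_le_of_dyadic_of_continuous {z : ℝ → ℝ} (hz : Continuous z) {r W : ℝ} (hr : 0 ≤ r)
    (hr1 : r < 1) (hW : 0 ≤ W)
    (h : ∀ k j : ℕ, |z ((j + 1) / 2 ^ k) - z (j / 2 ^ k)| ≤ W * r ^ k * (1 + j / 2 ^ k))
    {x : ℝ} (hx : 0 ≤ x) : |z x - z 0| ≤ W * (1 + x) ^ 2 * (1 - r)⁻¹ := by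
  have hlim : Tendsto (fun k : ℕ => (⌊x * (2 : ℝ) ^ k⌋₊ : ℝ) / 2 ^ k) atTop (𝓝 x) :=
    (tendsto_nat_floor_mul_div_atTop hx).comp (tendsto_pow_atTop_atTop_of_one_lt (by norm_num))
  refine le_of_tendsto_of_tendsto' (((hz.tendsto x).comp hlim).sub_const (z 0)).abs
    (((hlim.const_add 1).pow 2).const_mul W |>.mul_const (1 - r)⁻¹) fun k => ?_
  refine (abs_sub_le_of_dyadic hr hW h k _).trans (mul_le_mul_of_nonneg_left ?_ (by positivity))
  rw [← tsum_geometric_of_lt_one hr hr1]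
  exact (summable_geometric_of_lt_one hr hr1).sum_le_tsum _ fun i _ => by positivity

theorem exists_one_add_sq_le_mul_exp {μ : ℝ} (hμ : 0 < μ) :
    ∃ C, 0 ≤ C ∧ ∀ x : ℝ, 0 ≤ x → (1 + x) ^ 2 ≤ C * Real.exp (μ * x) := by
  refine ⟨2 + 4 / μ ^ 2, by positivity, fun x hx => ?_⟩
  have h := Real.quadratic_le_exp_of_nonneg (x := μ * x) (by positivity)
  have h0 : 0 ≤ μ * x := by positivity
  have h1 : 2 * (1 + x ^ 2) ≤ (2 + 4 / μ ^ 2) * (1 + (μ * x) ^ 2 / 2) := by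
    have : (2 + 4 / μ ^ 2) * (1 + (μ * x) ^ 2 / 2) =
        2 * (1 + x ^ 2) + (μ ^ 2 * x ^ 2 + 4 / μ ^ 2) := by field_simp; ring
    rw [this]
    exact le_add_of_nonneg_right (by positivity)
  have h2 : (2 + 4 / μ ^ 2) * (1 + (μ * x) ^ 2 / 2) ≤ (2 + 4 / μ ^ 2) * Real.exp (μ * x) :=
    mul_le_mul_of_nonneg_left (by linarith) (by positivity)
  nlinarith [sq_nonneg (1 - x)]

/-! ### Dyadic increments of processes whose increments have variance `|t - s| ^ (2 H)` -/

/-- A weighted sum of all squared dyadic increments has finite expectation, so it is almost surely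
finite and bounds each of its terms. At level `k` each unit interval carries `2 ^ k` increments of
second moment `2 ^ (-2 H k)`; the total decays geometrically exactly because `H > 1 / 2`. -/
theorem ae_exists_abs_dyadic_increment_le {Ω : Type*} [MeasurableSpace Ω] {P : Measure Ω} {H : ℝ}
    (hH : 1 / 2 < H) {z : ℝ → Ω → ℝ} (hz : ∀ t, AEMeasurable (z t) P)
    (hinc : ∀ s t, ∫⁻ ω, ENNReal.ofReal ((z t ω - z s ω) ^ 2) ∂P =
      ENNReal.ofReal (|t - s| ^ (2 * H))) :
    ∃ r : ℝ, 0 ≤ r ∧ r < 1 ∧ ∀ᵐ ω ∂P, ∃ W, 0 ≤ W ∧ ∀ k j : ℕ,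
      |z ((j + 1) / 2 ^ k) ω - z (j / 2 ^ k) ω| ≤ W * r ^ k * (1 + j / 2 ^ k) := by
  -- Chosen so that `r ^ 4 = 2 * 2 ^ (-2 H)`: one factor `r ^ 2` is spent on the weight `c`, the
  -- other keeps the series summable.
  set r : ℝ := 2 ^ ((1 - 2 * H) / 4) with hrdef
  have hr0 : 0 < r := by positivity
  have hr1 : r < 1 := Real.rpow_lt_one_of_one_lt_of_neg (by norm_num) (by linarith)
  have hr4 : r ^ 4 = 2 * (2⁻¹ : ℝ) ^ (2 * H) := by
    rw [hrdef, ← Real.rpow_natCast, ← Real.rpow_mul (by norm_num), Real.inv_rpow (by norm_num),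
      ← Real.rpow_neg (by norm_num)]
    have h2 : (2 : ℝ) * 2 ^ (-(2 * H)) = 2 ^ (1 + -(2 * H)) := by
      rw [Real.rpow_add (by norm_num), Real.rpow_one]
    rw [h2]
    congr 1; push_cast; ring
  refine ⟨r, hr0.le, hr1, ?_⟩
  -- The index is (dyadic level, unit interval); `m` below is the position inside that interval.
  set c : ℕ × ℕ → ℝ := fun i => (r ^ (2 * i.1))⁻¹ * ((1 + (i.2 : ℝ)) ^ 2)⁻¹ with hc
  set D : ℕ × ℕ → ℕ → Ω → ℝ := fun i m ω =>
    (z ((i.2 * 2 ^ i.1 + m + 1 : ℕ) / 2 ^ i.1) ω - z ((i.2 * 2 ^ i.1 + m : ℕ) / 2 ^ i.1) ω) ^ 2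
    with hD
  have hDm : ∀ i m, AEMeasurable (fun ω => ENNReal.ofReal (D i m ω)) P := fun i m =>
    (((hz _).sub (hz _)).pow_const 2).ennreal_ofReal
  have hDint : ∀ i m, ∫⁻ ω, ENNReal.ofReal (D i m ω) ∂P =
      ENNReal.ofReal (((2⁻¹ : ℝ) ^ (2 * H)) ^ i.1) := by
    intro i m
    simp only [hD]
    rw [hinc]
    congr 1
    have : (((i.2 * 2 ^ i.1 + m + 1 : ℕ) : ℝ) / 2 ^ i.1 - ((i.2 * 2 ^ i.1 + m : ℕ) : ℝ) / 2 ^ i.1)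
        = (2⁻¹) ^ i.1 := by
      rw [← sub_div, inv_pow, inv_eq_one_div]; push_cast; ring
    rw [this, abs_of_pos (by positivity), ← Real.rpow_natCast, ← Real.rpow_natCast,
      ← Real.rpow_mul (by norm_num), ← Real.rpow_mul (by norm_num), mul_comm]
  have hsum : ∫⁻ ω, ∑' i, ENNReal.ofReal (c i) * ∑ m ∈ Finset.range (2 ^ i.1),
      ENNReal.ofReal (D i m ω) ∂P ≠ ⊤ := by
    rw [lintegral_tsum fun i => (Finset.aemeasurable_fun_sum _ fun m _ => hDm i m).const_mul _]
    have : ∀ i : ℕ × ℕ, ∫⁻ ω, ENNReal.ofReal (c i) * ∑ m ∈ Finset.range (2 ^ i.1),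
        ENNReal.ofReal (D i m ω) ∂P =
        ENNReal.ofReal ((r ^ 2) ^ i.1 * ((1 + (i.2 : ℝ)) ^ 2)⁻¹) := by
      intro i
      rw [lintegral_const_mul'' _ (Finset.aemeasurable_fun_sum _ fun m _ => hDm i m),
        lintegral_finsetSum' _ fun m _ => hDm i m]
      simp only [hDint, Finset.sum_const, Finset.card_range, nsmul_eq_mul]
      rw [← ENNReal.ofReal_natCast, ← ENNReal.ofReal_mul (by positivity),
        ← ENNReal.ofReal_mul (by positivity)]
      congr 1
      have h4 : ((2 ^ i.1 : ℕ) : ℝ) * ((2⁻¹ : ℝ) ^ (2 * H)) ^ i.1 = (r ^ 4) ^ i.1 := by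
        rw [hr4, mul_pow]; push_cast; rfl
      rw [h4, hc, ← pow_mul, ← pow_mul]
      have : r ^ (4 * i.1) = r ^ (2 * i.1) * r ^ (2 * i.1) := by rw [← pow_add]; congr 1; ring
      rw [this]
      field_simp
    simp only [this]
    refine Summable.tsum_ofReal_ne_top ?_
    have s1 : Summable fun k : ℕ => (r ^ 2) ^ k :=
      summable_geometric_of_lt_one (by positivity) (by nlinarith)
    have s2 : Summable fun n : ℕ => ((1 + (n : ℝ)) ^ 2)⁻¹ := by
      have := (summable_nat_add_iff (f := fun n : ℕ => ((n : ℝ) ^ 2)⁻¹) 1).mpr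
        (Real.summable_nat_pow_inv.mpr (by norm_num))
      refine this.congr fun n => ?_
      push_cast; rw [add_comm]
    exact s1.mul_of_nonneg s2 (fun k => by positivity) (fun n => by positivity)
  have hae := ae_lt_top' (AEMeasurable.tsum fun i =>
    (Finset.aemeasurable_fun_sum _ fun m _ => hDm i m).const_mul (ENNReal.ofReal (c i))) hsum
  filter_upwards [hae] with ω hω
  set M := ∑' i, ENNReal.ofReal (c i) * ∑ m ∈ Finset.range (2 ^ i.1), ENNReal.ofReal (D i m ω)
    with hM
  refine ⟨√M.toReal, Real.sqrt_nonneg _, fun k j => ?_⟩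
  have hjm : j % 2 ^ k ∈ Finset.range (2 ^ k) :=
    Finset.mem_range.mpr (Nat.mod_lt _ (by positivity))
  have hj : j / 2 ^ k * 2 ^ k + j % 2 ^ k = j := Nat.div_add_mod' _ _
  have h1 : ENNReal.ofReal (c (k, j / 2 ^ k) * D (k, j / 2 ^ k) (j % 2 ^ k) ω) ≤ M := by
    rw [ENNReal.ofReal_mul (by positivity)]
    refine le_trans (mul_le_mul_right ?_ _) (ENNReal.le_tsum (k, j / 2 ^ k))
    exact Finset.single_le_sum (f := fun m => ENNReal.ofReal (D (k, j / 2 ^ k) m ω))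
      (fun _ _ => zero_le) hjm
  rw [ENNReal.ofReal_le_iff_le_toReal hω.ne] at h1
  simp only [hc, hD, hj] at h1
  have hq : ((j / 2 ^ k : ℕ) : ℝ) ≤ j / 2 ^ k := by
    have := Nat.cast_div_le (α := ℝ) (m := j) (n := 2 ^ k)
    simpa using this
  push_cast at h1
  set Δ := z ((j + 1) / 2 ^ k) ω - z (j / 2 ^ k) ω with hΔ
  have h2 : Δ ^ 2 ≤ (√M.toReal * r ^ k * (1 + ((j / 2 ^ k : ℕ) : ℝ))) ^ 2 := by
    rw [mul_pow, mul_pow, Real.sq_sqrt ENNReal.toReal_nonneg, ← pow_mul, mul_comm k 2, mul_assoc]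
    have hpos : 0 < r ^ (2 * k) * (1 + ((j / 2 ^ k : ℕ) : ℝ)) ^ 2 := by positivity
    rw [← div_le_iff₀ hpos]
    refine le_trans (le_of_eq ?_) h1
    rw [div_eq_mul_inv, mul_inv]
    ring
  refine (abs_le_of_sq_le_sq h2 (by positivity)).trans' (by simp) |>.trans ?_
  gcongr

/-! ### Measurable modifications -/

/-- Fubini needs joint measurability, hence everywhere continuous paths and measurable marginals.
The process is set to `0` on a measurable null set off which paths are continuous and agree with
measurable representatives at rational times; other times are limits of these. -/
theorem exists_measurable_continuous_modification {Ω : Type*} [MeasurableSpace Ω] {P : Measure Ω}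
    {B : ℝ → Ω → ℝ} (hB : ∀ t, AEMeasurable (B t) P)
    (hc : ∀ᵐ ω ∂P, Continuous fun t => B t ω) :
    ∃ B' : ℝ → Ω → ℝ, (∀ ω, Continuous fun t => B' t ω) ∧ (∀ t, Measurable (B' t)) ∧
      ∀ᵐ ω ∂P, ∀ t, B' t ω = B t ω := by
  have hq : ∀ᵐ ω ∂P, ∀ q : ℚ, B q ω = (hB q).mk _ ω := ae_all_iff.mpr fun q => (hB q).ae_eq_mk
  obtain ⟨N, hNsub, hNm, hN0⟩ := exists_measurable_superset_of_null (hc.and hq)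
  have hmem : ∀ ω, ω ∉ N → (Continuous fun t => B t ω) ∧ ∀ q : ℚ, B q ω = (hB q).mk _ ω :=
    fun ω hω => by
      by_contra hcon
      exact hω (hNsub hcon)
  have hcont : ∀ ω, Continuous fun t => Nᶜ.indicator (B t) ω := by
    intro ω
    by_cases hω : ω ∈ N
    · simpa [hω] using continuous_const
    · simpa [hω] using (hmem ω hω).1
  have hrat : ∀ q : ℚ, Measurable (Nᶜ.indicator (B q)) := by
    intro q
    have : Nᶜ.indicator (B q) = Nᶜ.indicator ((hB q).mk _) :=
      Set.indicator_congr fun ω hω => (hmem ω hω).2 q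
    rw [this]
    exact (hB q).measurable_mk.indicator hNm.compl
  refine ⟨fun t => Nᶜ.indicator (B t), hcont, fun t => ?_, ?_⟩
  · obtain ⟨x, hx, hxt⟩ := mem_closure_iff_seq_limit.mp (Rat.denseRange_cast (𝕜 := ℝ) t)
    choose q hq using hx
    refine measurable_of_tendsto_metrizable (f := fun n => Nᶜ.indicator (B (x n)))
      (fun n => by rw [← hq n]; exact hrat (q n)) (tendsto_pi_nhds.mpr fun ω => ?_)
    exact ((hcont ω).tendsto t).comp hxt
  · have : ∀ᵐ ω ∂P, ω ∉ N := measure_eq_zero_iff_ae_notMem.mp hN0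
    filter_upwards [this] with ω hω t
    simp [hω]

/-! ### Moments and growth of fractional Brownian motion -/

namespace IsFractionalBrownianMotion

variable {Ω : Type*} [MeasurableSpace Ω] {P : Measure Ω} {H : ℝ} {B : ℝ → Ω → ℝ}

theorem memLp_two (hB : IsFractionalBrownianMotion H B P) (t : ℝ) : MemLp (B t) 2 P :=
  (hB.gaussian.hasGaussianLaw_eval t).memLp_two

theorem integrable_mul (hB : IsFractionalBrownianMotion H B P) (s t : ℝ) :
    Integrable (fun ω => B s ω * B t ω) P :=
  (hB.memLp_two s).integrable_mul (hB.memLp_two t)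

theorem integral_increment_mul_increment (hB : IsFractionalBrownianMotion H B P) (a b c d : ℝ) :
    ∫ ω, (B b ω - B a ω) * (B d ω - B c ω) ∂P =
      (|b - c| ^ (2 * H) + |a - d| ^ (2 * H) - |b - d| ^ (2 * H) - |a - c| ^ (2 * H)) / 2 := by
  have e : ∀ ω, (B b ω - B a ω) * (B d ω - B c ω) =
      B b ω * B d ω - B b ω * B c ω - (B a ω * B d ω - B a ω * B c ω) := fun ω => by ring
  simp only [e]
  rw [integral_sub (by exact (hB.integrable_mul _ _).sub (hB.integrable_mul _ _))
      (by exact (hB.integrable_mul _ _).sub (hB.integrable_mul _ _)),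
    integral_sub (hB.integrable_mul _ _) (hB.integrable_mul _ _),
    integral_sub (hB.integrable_mul _ _) (hB.integrable_mul _ _)]
  simp only [hB.covariance]
  ring

theorem integral_increment_sq (hB : IsFractionalBrownianMotion H B P) (s t : ℝ) :
    ∫ ω, (B t ω - B s ω) ^ 2 ∂P = |t - s| ^ (2 * H) := by
  have h := hB.integral_increment_mul_increment s t s t
  have h0 : (0 : ℝ) ^ (2 * H) = 0 := Real.zero_rpow (by linarith [hB.hurst_mem.1])
  simp only [← sq, sub_self, abs_zero, h0, abs_sub_comm s t] at h
  rw [h]; ring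

theorem lintegral_increment_sq (hB : IsFractionalBrownianMotion H B P) (s t : ℝ) :
    ∫⁻ ω, ENNReal.ofReal ((B t ω - B s ω) ^ 2) ∂P = ENNReal.ofReal (|t - s| ^ (2 * H)) := by
  rw [← hB.integral_increment_sq, ofReal_integral_eq_lintegral_ofReal
    (by exact ((hB.memLp_two t).sub (hB.memLp_two s)).integrable_sq) (ae_of_all _ fun ω => sq_nonneg _)]

/-- Chaining for `B` and for its time reversal gives quadratic growth on both half-lines. -/
theorem ae_expGrowth (hB : IsFractionalBrownianMotion H B P) (hH : 1 / 2 < H) {μ : ℝ}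
    (hμ : 0 < μ) : ∀ᵐ ω ∂P, ExpGrowth μ fun t => B t ω := by
  have hm : ∀ t, AEMeasurable (B t) P := fun t => (hB.memLp_two t).aestronglyMeasurable.aemeasurable
  obtain ⟨r, hr0, hr1, h1⟩ := ae_exists_abs_dyadic_increment_le hH hm hB.lintegral_increment_sq
  obtain ⟨r', hr0', hr1', h2⟩ := ae_exists_abs_dyadic_increment_le hH (z := fun t => B (-t))
    (fun t => hm _) fun s t => by
      rw [hB.lintegral_increment_sq, ← abs_neg]
      congr 3; ring
  obtain ⟨C, hC0, hC⟩ := exists_one_add_sq_le_mul_exp hμ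
  filter_upwards [h1, h2, hB.continuous] with ω h1 h2 hc
  obtain ⟨W, hW, h1⟩ := h1
  obtain ⟨W', hW', h2⟩ := h2
  have k1 := fun x => abs_sub_le_of_dyadic_of_continuous hc hr0 hr1 hW h1 (x := x)
  have k2 := fun x => abs_sub_le_of_dyadic_of_continuous (z := fun t => B (-t) ω)
    (hc.comp continuous_neg) hr0' hr1' hW' h2 (x := x)
  have hR : 0 ≤ (1 - r)⁻¹ := by rw [inv_nonneg]; linarith
  have hR' : 0 ≤ (1 - r')⁻¹ := by rw [inv_nonneg]; linarith
  refine ⟨hc, |B 0 ω| + (W * (1 - r)⁻¹ + W' * (1 - r')⁻¹) * C, fun s => ?_⟩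
  have hexp : 1 ≤ Real.exp (μ * |s|) := Real.one_le_exp (by positivity)
  have key : |B s ω - B 0 ω| ≤ (W * (1 - r)⁻¹ + W' * (1 - r')⁻¹) * (1 + |s|) ^ 2 := by
    rcases le_total 0 s with hs | hs
    · refine (k1 s hs).trans ?_
      rw [abs_of_nonneg hs]
      nlinarith [mul_nonneg (mul_nonneg hW' hR') (sq_nonneg (1 + s))]
    · have := k2 (-s) (by linarith)
      simp only [neg_neg, neg_zero] at this
      refine this.trans ?_
      rw [abs_of_nonpos hs]
      nlinarith [mul_nonneg (mul_nonneg hW hR) (sq_nonneg (1 + -s))]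
  have hA : 0 ≤ W * (1 - r)⁻¹ + W' * (1 - r')⁻¹ := by positivity
  have h3 := mul_le_mul_of_nonneg_left (hC |s| (abs_nonneg s)) hA
  have h4 : |B s ω| ≤ |B 0 ω| + |B s ω - B 0 ω| := by
    have := abs_add_le (B 0 ω) (B s ω - B 0 ω)
    simpa using this
  have h5 := mul_le_mul_of_nonneg_left hexp (abs_nonneg (B 0 ω))
  linarith

end IsFractionalBrownianMotion

/-! ### The function `|s| ^ (2 H)` and its exponential convolution -/

theorem expGrowth_abs_rpow {H μ : ℝ} (hH0 : 0 < H) (hH1 : H ≤ 1) (hμ : 0 < μ) :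
    ExpGrowth μ fun s => |s| ^ (2 * H) := by
  obtain ⟨C, -, hC⟩ := exists_one_add_sq_le_mul_exp hμ
  refine ⟨continuous_abs.rpow_const fun _ => Or.inr (by linarith), C, fun s => ?_⟩
  rw [abs_of_nonneg (by positivity)]
  refine le_trans ?_ (hC |s| (abs_nonneg s))
  calc |s| ^ (2 * H) ≤ (1 + |s|) ^ (2 * H) :=
        Real.rpow_le_rpow (abs_nonneg s) (by linarith) (by linarith)
    _ ≤ (1 + |s|) ^ (2 : ℝ) :=
        Real.rpow_le_rpow_of_exponent_le (by linarith [abs_nonneg s]) (by linarith)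
    _ = _ := Real.rpow_two _

/-- Right derivatives suffice, so in the application `|x|` can be replaced by `x` on `x ≥ 0` only.
-/
theorem eq_zero_of_hasDerivWithinAt_eq_mul {g : ℝ → ℝ} {c : ℝ} (h0 : g 0 = 0)
    (hc : Continuous g) (hg : ∀ x, 0 ≤ x → HasDerivWithinAt g (c * g x) (Set.Ici x) x)
    {t : ℝ} (ht : 0 ≤ t) : g t = 0 := by
  have h := constant_of_has_deriv_right_zero (f := fun x => Real.exp (-(c * x)) * g x)
    (a := 0) (b := t) (by fun_prop) (fun x hx => ?_) t ⟨ht, le_rfl⟩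
  · simpa [h0] using h
  · have h1 : HasDerivAt (fun t => Real.exp (-(c * t))) (Real.exp (-(c * x)) * -(c * 1)) x :=
      (((hasDerivAt_id x).const_mul c).neg).exp
    exact (h1.hasDerivWithinAt.mul (hg x hx.1)).congr_deriv (by ring)

theorem hasDerivAt_fH1 {H : ℝ} (hH : 1 / 2 < H) (x : ℝ) :
    HasDerivAt (fH1 H) (-fH1 H x - x ^ (2 * H - 1)) x := by
  have hc : Continuous fun s : ℝ => Real.exp s * s ^ (2 * H - 1) :=
    Real.continuous_exp.mul (Real.continuous_rpow_const (by linarith))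
  have h1 := (hc.integral_hasStrictDerivAt 0 x).hasDerivAt.const_sub (Real.Gamma (2 * H))
  refine ((hasDerivAt_neg x).exp.mul h1).congr_deriv ?_
  have : Real.exp (-x) * Real.exp x = 1 := by rw [← Real.exp_add]; simp
  simp only [fH1]
  linear_combination -x ^ (2 * H - 1) * this

theorem hasDerivAt_fH2 {H : ℝ} (hH : 1 / 2 < H) (x : ℝ) :
    HasDerivAt (fH2 H) (fH2 H x - x ^ (2 * H - 1)) x := by
  have hc : Continuous fun s : ℝ => Real.exp (-s) * s ^ (2 * H - 1) :=
    (by fun_prop : Continuous fun s : ℝ => Real.exp (-s)).mul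
      (Real.continuous_rpow_const (by linarith))
  have h1 := (hc.integral_hasStrictDerivAt 0 x).hasDerivAt.const_sub (Real.Gamma (2 * H))
  refine ((Real.hasDerivAt_exp x).mul h1).congr_deriv ?_
  have : Real.exp (-x) * Real.exp x = 1 := by rw [← Real.exp_add]; simp
  simp only [fH2]
  linear_combination -x ^ (2 * H - 1) * this

theorem mul_expConv_abs_rpow_zero {H a : ℝ} (hH : 0 < H) (ha : 0 < a) :
    a * expConv a (fun s => |s| ^ (2 * H)) 0 = 2 * H * a ^ (-(2 * H)) * Real.Gamma (2 * H) := by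
  have h := Real.integral_rpow_mul_exp_neg_mul_Ioi (a := 2 * H + 1) (by linarith) ha
  have e : expConv a (fun s => |s| ^ (2 * H)) 0 =
      ∫ u in Set.Ioi (0 : ℝ), u ^ (2 * H + 1 - 1) * Real.exp (-(a * u)) := by
    rw [ExpGrowth.expConv_eq_integral_Ioi]
    refine setIntegral_congr_fun measurableSet_Ioi fun u hu => ?_
    simp only [zero_sub, abs_neg, abs_of_pos (Set.mem_Ioi.mp hu), add_sub_cancel_right]
    ring
  rw [e, h, Real.Gamma_add_one (by positivity), one_div, Real.inv_rpow ha.le,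
    Real.rpow_add_one ha.ne', Real.rpow_neg ha.le]
  field_simp

/-- The difference of the two sides satisfies `g' = -a g`, respectively `g' = a g`, on `t ≥ 0`, and
vanishes at `0` by the Gamma integral. -/
theorem mul_expConv_abs_rpow {H a : ℝ} (hH : 1 / 2 < H) (hH1 : H ≤ 1) (ha : 0 < a) {t : ℝ}
    (ht : 0 ≤ t) :
    a * expConv a (fun s => |s| ^ (2 * H)) t - t ^ (2 * H) =
        2 * H * a ^ (-(2 * H)) * fH1 H (a * t) ∧
      a * expConv a (fun s => |s| ^ (2 * H)) (-t) - t ^ (2 * H) =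
        2 * H * a ^ (-(2 * H)) * fH2 H (a * t) := by
  have hφ := expGrowth_abs_rpow (by linarith) hH1 (half_pos ha)
  have hU := fun x => hφ.hasDerivAt_expConv (half_pos ha).le (half_lt_self ha) x
  have hcU : Continuous (expConv a fun s => |s| ^ (2 * H)) :=
    continuous_iff_continuousAt.mpr fun x => (hU x).continuousAt
  have hc1 : Continuous (fH1 H) :=
    continuous_iff_continuousAt.mpr fun x => (hasDerivAt_fH1 hH x).continuousAt
  have hc2 : Continuous (fH2 H) :=
    continuous_iff_continuousAt.mpr fun x => (hasDerivAt_fH2 hH x).continuousAt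
  have hcp : Continuous fun x : ℝ => x ^ (2 * H) := Real.continuous_rpow_const (by linarith)
  have hp : ∀ x : ℝ, HasDerivAt (fun x : ℝ => x ^ (2 * H)) (2 * H * x ^ (2 * H - 1)) x :=
    fun x => Real.hasDerivAt_rpow_const (Or.inr (by linarith))
  have hm : ∀ x : ℝ, HasDerivAt (fun x => a * x) (a * 1) x :=
    fun x => (hasDerivAt_id x).const_mul a
  have hscale : ∀ x : ℝ, 0 ≤ x → a ^ (-(2 * H)) * ((a * x) ^ (2 * H - 1) * a) =
      x ^ (2 * H - 1) := by
    intro x hx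
    rw [Real.mul_rpow ha.le hx, Real.rpow_neg ha.le, Real.rpow_sub_one ha.ne']
    field_simp
  have h00 : (0 : ℝ) ^ (2 * H) = 0 := Real.zero_rpow (by linarith)
  have hzero := mul_expConv_abs_rpow_zero (by linarith : 0 < H) ha
  constructor
  · refine sub_eq_zero.mp (eq_zero_of_hasDerivWithinAt_eq_mul (c := -a)
      (g := fun t => a * expConv a (fun s => |s| ^ (2 * H)) t - t ^ (2 * H) -
        2 * H * a ^ (-(2 * H)) * fH1 H (a * t)) ?_ (by fun_prop) (fun x hx => ?_) ht)
    · simp only [hzero, h00, mul_zero]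
      simp [fH1]
    · have hd := (((hU x).const_mul a).sub (hp x)).sub
        (((hasDerivAt_fH1 hH (a * x)).comp x (hm x)).const_mul (2 * H * a ^ (-(2 * H))))
      refine hd.hasDerivWithinAt.congr_deriv ?_
      simp only [abs_of_nonneg hx]
      linear_combination 2 * H * hscale x hx
  · refine sub_eq_zero.mp (eq_zero_of_hasDerivWithinAt_eq_mul (c := a)
      (g := fun t => a * expConv a (fun s => |s| ^ (2 * H)) (-t) - t ^ (2 * H) -
        2 * H * a ^ (-(2 * H)) * fH2 H (a * t)) ?_ (by fun_prop) (fun x hx => ?_) ht)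
    · simp only [neg_zero, hzero, h00, mul_zero]
      simp [fH2]
    · have hd := ((((hU (-x)).comp x (hasDerivAt_neg x)).const_mul a).sub (hp x)).sub
        (((hasDerivAt_fH2 hH (a * x)).comp x (hm x)).const_mul (2 * H * a ^ (-(2 * H))))
      refine hd.hasDerivWithinAt.congr_deriv ?_
      simp only [abs_neg, abs_of_nonneg hx]
      linear_combination 2 * H * hscale x hx

theorem mul_expConv_abs_rpow_add {H a : ℝ} (hH : 1 / 2 < H) (hH1 : H ≤ 1) (ha : 0 < a) (t : ℝ) :
    (a * expConv a (fun s => |s| ^ (2 * H)) (-t) - |t| ^ (2 * H)) +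
      (a * expConv a (fun s => |s| ^ (2 * H)) t - |t| ^ (2 * H)) =
    2 * H * a ^ (-(2 * H)) * fH H (a * |t|) := by
  obtain ⟨h1, h2⟩ := mul_expConv_abs_rpow hH hH1 ha (abs_nonneg t)
  rw [fH, mul_add, ← h1, ← h2]
  rcases abs_choice t with h | h <;> rw [h]
  · ring
  · rw [neg_neg, add_comm]

/-! ### Covariances of Ornstein-Uhlenbeck transforms of fractional Brownian motion -/

theorem integral_mul_exp_neg_mul_Ioi {a : ℝ} (ha : 0 < a) :
    ∫ u in Set.Ioi (0 : ℝ), a * Real.exp (-(a * u)) = 1 := by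
  have := integral_exp_mul_Ioi (a := -a) (by linarith) 0
  simp only [neg_mul, mul_zero, Real.exp_zero] at this
  rw [integral_const_mul, this]
  field_simp

theorem integrableOn_exp_neg_mul_Ioi {a : ℝ} (ha : 0 < a) :
    IntegrableOn (fun u => Real.exp (-(a * u))) (Set.Ioi 0) := by
  simpa using integrableOn_exp_mul_Ioi (a := -a) (by linarith) 0

namespace ExpGrowth

variable {μ a : ℝ} {y : ℝ → ℝ}

theorem integrableOn_exp_neg_mul_increment (hy : ExpGrowth μ y) (hμ : 0 ≤ μ) (ha : μ < a)
    (t : ℝ) : IntegrableOn (fun u => a * Real.exp (-(a * u)) * (y t - y (t - u))) (Set.Ioi 0) := by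
  have h1 := (integrableOn_exp_neg_mul_Ioi (hμ.trans_lt ha)).mul_const (a * y t)
  have h2 := (hy.integrableOn_Ioi hμ ha t).const_mul a
  refine (h1.sub h2).congr (ae_of_all _ fun u => ?_)
  simp only [Pi.sub_apply]; ring

/-- The density `a exp (-a u)` has mass one, so `T_a y` is an average of increments of `y`. -/
theorem sub_mul_expConv_eq_integral (hy : ExpGrowth μ y) (hμ : 0 ≤ μ) (ha : μ < a) (t : ℝ) :
    y t - a * _root_.expConv a y t =
      ∫ u in Set.Ioi 0, a * Real.exp (-(a * u)) * (y t - y (t - u)) := by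
  have ha0 := hμ.trans_lt ha
  have h2 := (hy.integrableOn_Ioi hμ ha t).const_mul a
  have e : ∀ u, a * Real.exp (-(a * u)) * (y t - y (t - u)) =
      a * Real.exp (-(a * u)) * y t - a * (Real.exp (-(a * u)) * y (t - u)) := fun u => by ring
  simp only [e]
  rw [integral_sub (((integrableOn_exp_neg_mul_Ioi ha0).const_mul a).mul_const _) h2,
    integral_mul_const, integral_mul_exp_neg_mul_Ioi ha0, integral_const_mul,
    ← expConv_eq_integral_Ioi, one_mul]

end ExpGrowth

namespace IsFractionalBrownianMotion

variable {Ω : Type*} [MeasurableSpace Ω] {P : Measure Ω} {H : ℝ} {B : ℝ → Ω → ℝ}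

theorem exists_measurable_continuous (hB : IsFractionalBrownianMotion H B P) :
    ∃ B' : ℝ → Ω → ℝ, IsFractionalBrownianMotion H B' P ∧ (∀ ω, Continuous fun t => B' t ω) ∧
      (∀ t, Measurable (B' t)) ∧ ∀ᵐ ω ∂P, ∀ t, B' t ω = B t ω := by
  obtain ⟨B', hc, hm, hBB⟩ := exists_measurable_continuous_modification
    (fun t => hB.gaussian.aemeasurable t) hB.continuous
  refine ⟨B', ⟨hB.hurst_mem, hB.gaussian.congr fun t => ?_, fun t => ?_, fun t s => ?_,
    ae_of_all _ hc⟩, hc, hm, hBB⟩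
  · filter_upwards [hBB] with ω h using (h t).symm
  · rw [← hB.centered t]
    exact integral_congr_ae (by filter_upwards [hBB] with ω h using h t)
  · rw [← hB.covariance t s]
    exact integral_congr_ae (by filter_upwards [hBB] with ω h; rw [h t, h s])

theorem integral_abs_increment_mul_increment_le (hB : IsFractionalBrownianMotion H B P)
    (a b c d : ℝ) : ∫ ω, |(B b ω - B a ω) * (B d ω - B c ω)| ∂P ≤
      |b - a| ^ (2 * H) + |d - c| ^ (2 * H) := by
  have h1 := (hB.memLp_two b).sub (hB.memLp_two a)
  have h2 := (hB.memLp_two d).sub (hB.memLp_two c)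
  rw [← hB.integral_increment_sq, ← hB.integral_increment_sq,
    ← integral_add (by exact h1.integrable_sq) (by exact h2.integrable_sq)]
  refine integral_mono (h1.integrable_mul h2).abs (h1.integrable_sq.add h2.integrable_sq)
    fun ω => ?_
  rw [abs_mul, ← sq_abs (B b ω - B a ω), ← sq_abs (B d ω - B c ω)]
  nlinarith [sq_nonneg (|B b ω - B a ω| - |B d ω - B c ω|), abs_nonneg (B b ω - B a ω),
    abs_nonneg (B d ω - B c ω)]

/-- The hypothesis of Fubini: the mean absolute product of increments is at most `|u| ^ (2 H) + |v|
^ (2 H)`, integrable against the exponential weights. -/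
theorem integrable_weighted_increments (hB : IsFractionalBrownianMotion H B P)
    (hc : ∀ ω, Continuous fun t => B t ω) (hm : ∀ t, Measurable (B t)) {a b : ℝ} (ha : 0 < a)
    (hb : 0 < b) (s t : ℝ) :
    Integrable (fun x : (ℝ × ℝ) × Ω => (a * Real.exp (-(a * x.1.1)) * (B s x.2 - B (s - x.1.1) x.2))
        * (b * Real.exp (-(b * x.1.2)) * (B t x.2 - B (t - x.1.2) x.2)))
      (((volume.restrict (Set.Ioi 0)).prod (volume.restrict (Set.Ioi 0))).prod P) := by
  have : IsProbabilityMeasure P := hB.gaussian.isProbabilityMeasure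
  have hj : Measurable (Function.uncurry B) := measurable_uncurry_of_continuous_of_measurable hc hm
  have hj' : ∀ {f : (ℝ × ℝ) × Ω → ℝ}, Measurable f → Measurable fun x => B (f x) x.2 :=
    fun hf => hj.comp (hf.prodMk measurable_snd)
  have hmeas : Measurable (fun x : (ℝ × ℝ) × Ω =>
      (a * Real.exp (-(a * x.1.1)) * (B s x.2 - B (s - x.1.1) x.2))
        * (b * Real.exp (-(b * x.1.2)) * (B t x.2 - B (t - x.1.2) x.2))) := by
    have m1 := hj' (f := fun _ => s) (by fun_prop)
    have m2 := hj' (f := fun x => s - x.1.1) (by fun_prop)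
    have m3 := hj' (f := fun _ => t) (by fun_prop)
    have m4 := hj' (f := fun x => t - x.1.2) (by fun_prop)
    fun_prop
  have e : ∀ (x : ℝ × ℝ) (ω : Ω), (a * Real.exp (-(a * x.1)) * (B s ω - B (s - x.1) ω))
        * (b * Real.exp (-(b * x.2)) * (B t ω - B (t - x.2) ω)) =
      (a * Real.exp (-(a * x.1)) * (b * Real.exp (-(b * x.2)))) *
        ((B s ω - B (s - x.1) ω) * (B t ω - B (t - x.2) ω)) := fun x ω => by ring
  refine (integrable_prod_iff hmeas.aestronglyMeasurable).mpr ⟨ae_of_all _ fun x => ?_, ?_⟩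
  · simp only [e]
    exact (((hB.memLp_two _).sub (hB.memLp_two _)).integrable_mul
      ((hB.memLp_two _).sub (hB.memLp_two _))).const_mul _
  · have hφ : ∀ c : ℝ, 0 < c → IntegrableOn (fun u => c * Real.exp (-(c * u)) * |u| ^ (2 * H))
        (Set.Ioi 0) := by
      intro c hc
      have := ((expGrowth_abs_rpow hB.hurst_mem.1 hB.hurst_mem.2 (half_pos hc)).integrableOn_Ioi
        (half_pos hc).le (half_lt_self hc) 0).const_mul c
      simpa [mul_assoc, IntegrableOn] using this
    have hexp : ∀ c : ℝ, 0 < c → IntegrableOn (fun u => c * Real.exp (-(c * u))) (Set.Ioi 0) :=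
      fun c hc => (integrableOn_exp_neg_mul_Ioi hc).const_mul c
    have hbound := (Integrable.mul_prod (hφ a ha) (hexp b hb)).add
      (Integrable.mul_prod (hexp a ha) (hφ b hb))
    refine hbound.mono' hmeas.norm.stronglyMeasurable.integral_prod_right.aestronglyMeasurable
      (ae_of_all _ fun x => ?_)
    have hn : 0 ≤ ∫ ω, ‖(a * Real.exp (-(a * x.1)) * (B s ω - B (s - x.1) ω))
        * (b * Real.exp (-(b * x.2)) * (B t ω - B (t - x.2) ω))‖ ∂P :=
      integral_nonneg fun _ => norm_nonneg _
    rw [Real.norm_of_nonneg hn]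
    simp only [e, norm_mul (a * _ * _), Real.norm_eq_abs]
    rw [integral_const_mul, abs_of_nonneg (by positivity)]
    have hle := hB.integral_abs_increment_mul_increment_le (s - x.1) s (t - x.2) t
    rw [sub_sub_cancel, sub_sub_cancel] at hle
    refine (mul_le_mul_of_nonneg_left hle (by positivity)).trans_eq ?_
    simp only [Pi.add_apply]
    ring

theorem integrable_ou_mul_ou (hB : IsFractionalBrownianMotion H B P) (hH : 1 / 2 < H)
    (hc : ∀ ω, Continuous fun t => B t ω) (hm : ∀ t, Measurable (B t)) {a b : ℝ} (ha : 0 < a)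
    (hb : 0 < b) (s t : ℝ) :
    Integrable (fun ω => (B s ω - a * expConv a (fun r => B r ω) s) *
        (B t ω - b * expConv b (fun r => B r ω) t)) P ∧
      ∫ ω, (B s ω - a * expConv a (fun r => B r ω) s) *
          (B t ω - b * expConv b (fun r => B r ω) t) ∂P =
        ∫ u in Set.Ioi 0, ∫ v in Set.Ioi 0, (a * Real.exp (-(a * u))) * (b * Real.exp (-(b * v))) *
          ∫ ω, (B s ω - B (s - u) ω) * (B t ω - B (t - v) ω) ∂P := by
  have : IsProbabilityMeasure P := hB.gaussian.isProbabilityMeasure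
  have hF := hB.integrable_weighted_increments hc hm ha hb s t
  have hab : 0 < min a b / 2 := half_pos (lt_min ha hb)
  have hμa : min a b / 2 < a := (half_lt_self (lt_min ha hb)).trans_le (min_le_left _ _)
  have hμb : min a b / 2 < b := (half_lt_self (lt_min ha hb)).trans_le (min_le_right _ _)
  have hprod : (fun ω => ∫ x : ℝ × ℝ,
      (a * Real.exp (-(a * x.1)) * (B s ω - B (s - x.1) ω))
        * (b * Real.exp (-(b * x.2)) * (B t ω - B (t - x.2) ω))
        ∂((volume.restrict (Set.Ioi 0)).prod (volume.restrict (Set.Ioi 0)))) =ᵐ[P]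
      fun ω => (B s ω - a * expConv a (fun r => B r ω) s) *
        (B t ω - b * expConv b (fun r => B r ω) t) := by
    filter_upwards [hB.ae_expGrowth hH hab] with ω hω
    rw [hω.sub_mul_expConv_eq_integral hab.le hμa, hω.sub_mul_expConv_eq_integral hab.le hμb]
    exact integral_prod_mul (fun u => a * Real.exp (-(a * u)) * (B s ω - B (s - u) ω))
      (fun v => b * Real.exp (-(b * v)) * (B t ω - B (t - v) ω))
  refine ⟨hF.integral_prod_right.congr hprod, ?_⟩
  rw [← integral_congr_ae hprod, ← integral_integral_swap
    (f := fun (x : ℝ × ℝ) ω => (a * Real.exp (-(a * x.1)) * (B s ω - B (s - x.1) ω))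
        * (b * Real.exp (-(b * x.2)) * (B t ω - B (t - x.2) ω))) hF,
    integral_prod _ hF.integral_prod_left]
  simp only [← integral_const_mul]
  congr! 6
  ring

/-- The covariance of two Ornstein-Uhlenbeck transforms of a fractional Brownian motion. -/
theorem integral_ou_mul_ou (hB : IsFractionalBrownianMotion H B P) (hH : 1 / 2 < H)
    (hc : ∀ ω, Continuous fun t => B t ω) (hm : ∀ t, Measurable (B t)) {a b : ℝ} (ha : 0 < a)
    (hb : 0 < b) (t : ℝ) :
    ∫ ω, (B 0 ω - a * expConv a (fun r => B r ω) 0) *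
        (B t ω - b * expConv b (fun r => B r ω) t) ∂P =
      (a * (a * expConv a (fun s => |s| ^ (2 * H)) (-t) - |t| ^ (2 * H)) +
        b * (b * expConv b (fun s => |s| ^ (2 * H)) t - |t| ^ (2 * H))) / (a + b) / 2 := by
  rw [(hB.integrable_ou_mul_ou hH hc hm ha hb 0 t).2]
  set μ := min a b / 2 with hμdef
  have hμ : 0 < μ := half_pos (lt_min ha hb)
  have hμa : μ < a := (half_lt_self (lt_min ha hb)).trans_le (min_le_left _ _)
  have hμb : μ < b := (half_lt_self (lt_min ha hb)).trans_le (min_le_right _ _)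
  have hφ := expGrowth_abs_rpow hB.hurst_mem.1 hB.hurst_mem.2 hμ
  set φ : ℝ → ℝ := fun s => |s| ^ (2 * H) with hφdef
  have heven : ∀ s, φ (-s) = φ s := fun s => by simp [hφdef]
  have hφ0 : φ 0 = 0 := by
    simp only [hφdef, abs_zero]; exact Real.zero_rpow (by linarith)
  -- The time reversal of `T_b φ`. Integrating over `v` leaves an increment of `ψ` ending at `-t`,
  -- so the integral over `u` is `T_a ψ (-t)` up to the factor `-1 / 2`.
  set ψ : ℝ → ℝ := fun s => φ (-s) - b * expConv b φ (-s) with hψdef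
  have hψ : ExpGrowth μ ψ := (hφ.sub_const_mul (hφ.expConv hμ.le hμb) b).comp_neg
  have hinner : ∀ u, ∫ v in Set.Ioi 0, (a * Real.exp (-(a * u))) * (b * Real.exp (-(b * v))) *
      ∫ ω, (B 0 ω - B (0 - u) ω) * (B t ω - B (t - v) ω) ∂P =
      -(1 / 2) * (a * Real.exp (-(a * u)) * (ψ (-t) - ψ (-t - u))) := by
    intro u
    have e : ∀ v, (a * Real.exp (-(a * u))) * (b * Real.exp (-(b * v))) *
        ∫ ω, (B 0 ω - B (0 - u) ω) * (B t ω - B (t - v) ω) ∂P =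
        (a * Real.exp (-(a * u)) / 2) *
          (b * Real.exp (-(b * v)) * (φ (t + u) - φ (t + u - v)) -
            b * Real.exp (-(b * v)) * (φ t - φ (t - v))) := by
      intro v
      rw [hB.integral_increment_mul_increment]
      have e1 : |0 - (t - v)| ^ (2 * H) = φ (t - v) := by rw [zero_sub, abs_neg]
      have e2 : |0 - u - t| ^ (2 * H) = φ (t + u) := by
        rw [← heven]; simp only [hφdef]; congr 2; ring
      have e3 : |0 - t| ^ (2 * H) = φ t := by rw [zero_sub, abs_neg]
      have e4 : |0 - u - (t - v)| ^ (2 * H) = φ (t + u - v) := by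
        rw [← heven]; simp only [hφdef]; congr 2; ring
      rw [e1, e2, e3, e4]; ring
    simp only [e]
    rw [integral_const_mul, integral_sub (hφ.integrableOn_exp_neg_mul_increment hμ.le hμb _)
      (hφ.integrableOn_exp_neg_mul_increment hμ.le hμb _),
      ← hφ.sub_mul_expConv_eq_integral hμ.le hμb, ← hφ.sub_mul_expConv_eq_integral hμ.le hμb]
    have e5 : -(-t - u) = t + u := by ring
    simp only [hψdef, e5, neg_neg]
    ring
  simp only [hinner]
  rw [integral_const_mul, ← hψ.sub_mul_expConv_eq_integral hμ.le hμa]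
  have hU : expConv a ψ (-t) = expConv a φ (-t) - b *
      ((expConv a φ (-t) + expConv b φ t) / (a + b)) := by
    simp only [hψdef, heven]
    rw [expConv_sub_const_mul _ _ _ _ _ (hφ.integrableOn_Iic hμ.le hμa _)
      ((hφ.expConv hμ.le hμb).comp_neg.integrableOn_Iic hμ.le hμa _),
      hφ.expConv_comp_neg_expConv heven hμ.le hμa hμb, neg_neg]
  rw [hU]
  have hab : a + b ≠ 0 := by positivity
  have e6 : |t| ^ (2 * H) = φ t := rfl
  simp only [hψdef, neg_neg, e6]
  field_simp
  ring

end IsFractionalBrownianMotion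

theorem exists_pos_lt_of_forall_pos {p : ℕ} {lam : Fin (p + 1) → ℝ} (h : ∀ i, 0 < lam i) :
    ∃ μ, 0 < μ ∧ ∀ i, μ < lam i := by
  obtain ⟨i, hi⟩ := Finite.exists_min lam
  exact ⟨lam i / 2, half_pos (h i), fun j => (half_lt_self (h i)).trans_le (hi j)⟩

theorem expConv_const_mul (a c : ℝ) (y : ℝ → ℝ) (t : ℝ) :
    expConv a (fun s => c * y s) t = c * expConv a y t := by
  simp only [expConv, mul_left_comm _ c, integral_const_mul]

/-- The kernel splits into an `α i` part and a `β j` part; in each, the sum over the other index is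
the partial fraction sum already evaluated. -/
theorem sum_sum_pow_mul_nodalWeight_mul_div_add {p : ℕ} {v : Fin (p + 1) → ℝ}
    (hv : Function.Injective v) (hpos : ∀ i, 0 < v i) (α β : Fin (p + 1) → ℝ) :
    ∑ i, ∑ j, v i ^ p * Lagrange.nodalWeight Finset.univ v i *
        (v j ^ p * Lagrange.nodalWeight Finset.univ v j) *
          ((v i * α i + v j * β j) / (v i + v j)) =
      ∑ i, v i ^ (2 * p) / (∏ j ∈ Finset.univ.erase i, (v i ^ 2 - v j ^ 2)) / 2 *
        (α i + β i) := by
  have e : ∀ i j, v i ^ p * Lagrange.nodalWeight Finset.univ v i *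
        (v j ^ p * Lagrange.nodalWeight Finset.univ v j) *
          ((v i * α i + v j * β j) / (v i + v j)) =
      α i * (v i ^ p * Lagrange.nodalWeight Finset.univ v i * v i *
        (v j ^ p * Lagrange.nodalWeight Finset.univ v j / (v i + v j))) +
      β j * (v j ^ p * Lagrange.nodalWeight Finset.univ v j * v j *
        (v i ^ p * Lagrange.nodalWeight Finset.univ v i / (v j + v i))) := by
    intro i j
    rw [add_comm (v j) (v i)]
    ring
  simp only [e, Finset.sum_add_distrib]
  rw [Finset.sum_comm (f := fun i j => β j * _)]
  simp only [← Finset.mul_sum, sum_pow_mul_nodalWeight_div_add hv hpos]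
  rw [← Finset.sum_add_distrib]
  exact Finset.sum_congr rfl fun i _ => by ring

/-- There are `p + 1` parameters here, so `p = 0` covers the processes with a single parameter as
well. -/
theorem IsFOU.integral_mul {Ω : Type*} [MeasurableSpace Ω] {P : Measure Ω} {p : ℕ}
    {lam : Fin (p + 1) → ℝ} {σ H : ℝ} {X : ℝ → Ω → ℝ} (hX : IsFOU lam σ H X P) (hH : 1 / 2 < H)
    (t : ℝ) :
    Integrable (fun ω => X 0 ω * X t ω) P ∧
      ∫ ω, X 0 ω * X t ω ∂P =
        ∑ i, lam i ^ (2 * p) / (∏ j ∈ Finset.univ.erase i, (lam i ^ 2 - lam j ^ 2)) *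
          (σ ^ 2 * H / 2 * lam i ^ (-(2 * H)) * fH H (lam i * |t|)) := by
  obtain ⟨B₀, hB₀, hXB⟩ := hX.exists_fbm
  obtain ⟨B, hB, hc, hm, hBB⟩ := hB₀.exists_measurable_continuous
  obtain ⟨μ, hμ, hlam⟩ := exists_pos_lt_of_forall_pos hX.lam_pos
  set K : Fin (p + 1) → ℝ := fun i => lam i ^ p * Lagrange.nodalWeight Finset.univ lam i with hK
  have hrep : ∀ s, X s =ᵐ[P] fun ω => ∑ i, K i *
      (σ * (B s ω - lam i * expConv (lam i) (fun r => B r ω) s)) := by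
    intro s
    filter_upwards [hXB s, hBB, hB.ae_expGrowth hH hμ] with ω h1 h2 h3
    simp only [h1, ← h2]
    rw [(h3.const_mul σ).ouComposition_eq hμ.le lam hX.lam_injective hlam]
    refine Finset.sum_congr rfl fun i _ => ?_
    rw [expConv_const_mul]
    ring
  have hpair := fun i j => hB.integrable_ou_mul_ou hH hc hm (hX.lam_pos i) (hX.lam_pos j) 0 t
  have hXX : (fun ω => X 0 ω * X t ω) =ᵐ[P] fun ω => ∑ i, ∑ j, K i * K j * σ ^ 2 *
      ((B 0 ω - lam i * expConv (lam i) (fun r => B r ω) 0) *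
        (B t ω - lam j * expConv (lam j) (fun r => B r ω) t)) := by
    filter_upwards [hrep 0, hrep t] with ω h0 ht
    rw [h0, ht, Finset.sum_mul_sum]
    exact Finset.sum_congr rfl fun i _ => Finset.sum_congr rfl fun j _ => by ring
  have hint : ∀ i j, Integrable (fun ω => K i * K j * σ ^ 2 *
      ((B 0 ω - lam i * expConv (lam i) (fun r => B r ω) 0) *
        (B t ω - lam j * expConv (lam j) (fun r => B r ω) t))) P :=
    fun i j => (hpair i j).1.const_mul _
  refine ⟨(integrable_finsetSum _ fun i _ => integrable_finsetSum _ fun j _ =>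
    hint i j).congr hXX.symm, ?_⟩
  rw [integral_congr_ae hXX,
    integral_finsetSum _ fun i _ => integrable_finsetSum _ fun j _ => hint i j]
  have hval : ∀ i, ∫ ω, ∑ j, K i * K j * σ ^ 2 *
      ((B 0 ω - lam i * expConv (lam i) (fun r => B r ω) 0) *
        (B t ω - lam j * expConv (lam j) (fun r => B r ω) t)) ∂P =
      ∑ j, σ ^ 2 / 2 * (K i * K j *
        ((lam i * (lam i * expConv (lam i) (fun s => |s| ^ (2 * H)) (-t) - |t| ^ (2 * H)) +
          lam j * (lam j * expConv (lam j) (fun s => |s| ^ (2 * H)) t - |t| ^ (2 * H))) /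
            (lam i + lam j))) := by
    intro i
    rw [integral_finsetSum _ fun j _ => hint i j]
    refine Finset.sum_congr rfl fun j _ => ?_
    rw [integral_const_mul, hB.integral_ou_mul_ou hH hc hm (hX.lam_pos i) (hX.lam_pos j)]
    ring
  rw [Finset.sum_congr rfl fun i _ => hval i]
  simp only [← Finset.mul_sum, hK]
  rw [sum_sum_pow_mul_nodalWeight_mul_div_add hX.lam_injective hX.lam_pos
    (fun i => lam i * expConv (lam i) (fun s => |s| ^ (2 * H)) (-t) - |t| ^ (2 * H))
    (fun i => lam i * expConv (lam i) (fun s => |s| ^ (2 * H)) t - |t| ^ (2 * H)), Finset.mul_sum]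
  refine Finset.sum_congr rfl fun i _ => ?_
  rw [mul_expConv_abs_rpow_add hH hB.hurst_mem.2 (hX.lam_pos i)]
  ring

/-- The autocovariance of a `FOU(lam 1, …, lam p, σ, H)` process with `p ≥ 2` and `H > 1/2`, in
closed form and as a linear combination of the autocovariances of `FOU(lam i, σ, H)` processes. -/
theorem proposition3 {Ω : Type*} [MeasurableSpace Ω] (P : Measure Ω) [IsProbabilityMeasure P]
    (p : ℕ) (hp : 2 ≤ p) (lam : Fin p → ℝ) (σ H : ℝ) (hH : 1 / 2 < H)
    (X : ℝ → Ω → ℝ) (hX : IsFOU lam σ H X P) (t : ℝ) :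
    Integrable (fun ω => X 0 ω * X t ω) P ∧
    ∫ ω, X 0 ω * X t ω ∂P =
      σ ^ 2 * H / 2 * ∑ i, lam i ^ (2 * (p : ℝ) - 2 * H - 2) /
        (∏ j ∈ Finset.univ.erase i, (lam i ^ 2 - lam j ^ 2)) * fH H (lam i * |t|) ∧
    ∀ (Ω' : Fin p → Type*) [∀ i, MeasurableSpace (Ω' i)] (P' : ∀ i, Measure (Ω' i))
      [∀ i, IsProbabilityMeasure (P' i)] (Y : ∀ i, ℝ → Ω' i → ℝ),
      (∀ i, IsFOU (fun _ : Fin 1 => lam i) σ H (Y i) (P' i)) →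
      (∀ i, Integrable (fun ω => Y i 0 ω * Y i t ω) (P' i)) ∧
      ∫ ω, X 0 ω * X t ω ∂P =
        ∑ i, lam i ^ (2 * p - 2) / (∏ j ∈ Finset.univ.erase i, (lam i ^ 2 - lam j ^ 2)) *
          ∫ ω, Y i 0 ω * Y i t ω ∂(P' i) := by
  obtain ⟨q, rfl⟩ : ∃ q, p = q + 1 := ⟨p - 1, by omega⟩
  obtain ⟨hint, hval⟩ := hX.integral_mul hH t
  refine ⟨hint, ?_, ?_⟩
  · rw [hval, Finset.mul_sum]
    refine Finset.sum_congr rfl fun i _ => ?_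
    have e : lam i ^ (2 * ((q + 1 : ℕ) : ℝ) - 2 * H - 2) =
        lam i ^ (2 * q) * lam i ^ (-(2 * H)) := by
      rw [← Real.rpow_natCast, ← Real.rpow_add (hX.lam_pos i)]
      congr 1; push_cast; ring
    rw [e]
    ring
  · intro Ω' _ P' _ Y hY
    have hYv := fun i => (hY i).integral_mul hH t
    refine ⟨fun i => (hYv i).1, ?_⟩
    rw [hval]
    refine Finset.sum_congr rfl fun i _ => ?_
    -- With a single parameter the power is `0` and the product is empty, so the covariance of `Y i`
    -- is exactly the remaining factor of the `i`-th summand.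
    rw [(hYv i).2, show 2 * (q + 1) - 2 = 2 * q by omega]
    simp
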